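/- Let $(W,S)$ be a finite Coxeter system with length function $\ell$. Put $D(w)=\{s\in S:\ell(ws)<\ell(w)\}$ for $w\in W$, and $D_I(W)=\{w\in W:D(w)=I\}$ for $I\subseteq S$; a subset of $W$ is identified with the sum of its elements in $\mathbb{Z}W$. Let $\Sigma(W)\subseteq\mathbb{Z}W$ be the $\mathbb{Z}$-span of all $D_I(W)$, $I\subseteq S$, let $\Sigma^*(W)$ be its dual $\mathbb{Z}$-module, and let $\chi:\mathbb{Z}W\to\Sigma^*(W)$ be dual to the inclusion $\imath:\Sigma(W)\hookrightarrow\mathbb{Z}W$ with respect to the form $\langle u,v\rangle=\delta_{u,v}$ $(u,v\in W)$ on $\mathbb{Z}W$. Put $\chi'(w)=\chi(w^{-1})$, $\Lambda(W)=\chi'(\Sigma(W))\subseteq\Sigma^*(W)$ and $\Lambda_I(W)=\chi'(D_I(W))$. For $I\subseteq S$ let $W_I=\langle I\rangle$, $W^I=\{w:D(w)\subseteq S\setminus I\}$, ${}^IW=\{w:D(w^{-1})\subseteq S\setminus I\}$, and write $w=w_I\cdot{}^Iw=w^I\cdot{}_Iw$ with $w_I,{}_Iw\in W_I$, ${}^Iw\in{}^IW$,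 $w^I\in W^I$. Define linear maps $\mu,\bar\mu:\mathbb{Z}W_I\to\mathbb{Z}W$ by $\mu(u)=W^I\cdot u$, $\bar\mu(u)=u\cdot{}^IW$, and $\rho,\bar\rho:\mathbb{Z}W\to\mathbb{Z}W_I$ by $\rho(w)=w_I$, $\bar\rho(w)={}_Iw$. 1. There is a unique bilinear form on $\Lambda(W)$ with $\langle\Lambda_I(W),\Lambda_J(W)\rangle=\#\{w\in W:D(w^{-1})=I,\ D(w)=J\}$ for all $I,J\subseteq S$. It is symmetric and nondegenerate. 2. Let $I\subseteq S$. The maps $\mu,\rho$ restrict to $\mu:\Sigma(W_I)\to\Sigma(W)$ and $\rho:\Sigma(W)\to\Sigma(W_I)$; the maps $\bar\mu,\bar\rho$ descend along $\chi$ to maps between $\Sigma^*(W_I)$ and $\Sigma^*(W)$, and these restrict to maps between $\Lambda(W_I)$ and $\Lambda(W)$. The diagram $$\begin{array}{ccccc} \Sigma(W_I)&\overset{\chi'}{\twoheadrightarrow}&\Lambda(W_I)&\overset{\imath}{\hookrightarrow}&\Sigma^*(W_I)\\ \downarrow{\scriptstyle\mu}&&\downarrow{\scriptstyle\bar\mu}&&\downarrow{\scriptstyle\bar\mu}\\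 \Sigma(W)&\overset{\chi'}{\twoheadrightarrow}&\Lambda(W)&\overset{\imath}{\hookrightarrow}&\Sigma^*(W)\\ \downarrow{\scriptstyle\rho}&&\downarrow{\scriptstyle\bar\rho}&&\downarrow{\scriptstyle\bar\rho}\\ \Sigma(W_I)&\overset{\chi'}{\twoheadrightarrow}&\Lambda(W_I)&\overset{\imath}{\hookrightarrow}&\Sigma^*(W_I) \end{array}$$ commutes, and rotating it by $180^\circ$ gives the dual diagram: with respect to the pairing of $\Sigma$ with $\Sigma^*$ and the forms on $\Lambda$, the map $\bar\rho$ on $\Sigma^*$ is dual to $\mu$ on $\Sigma$, the map $\bar\mu$ on $\Sigma^*$ is dual to $\rho$ on $\Sigma$, the maps $\bar\mu$ and $\bar\rho$ on $\Lambda$ are adjoint to each other, and in every row $\chi'$ and $\imath$ are adjoint to each other, i.e. $\langle\chi'(x),y\rangle=\imath(y)(x)$. 3. Let $\mathcal Cox$ be the category of finite Coxeter systems whose morphisms $(W',S')\to(W,S)$ are the injective group homomorphisms $f:W'\to W$ with $f(S')\subseteq S$; such an $f$ identifies $(W',S')$ with $(W_I,I)$ for $I=f(S')$, so the maps above are defined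 for $f$. Then $\Omega:(W,S)\mapsto\mathbb{Z}W$ (with $\mu$, respectively $\rho$), $\Sigma$ (with $\mu$, respectively $\rho$), $\Sigma^*$ and $\Lambda$ (each with $\bar\mu$, respectively $\bar\rho$) are functors from $\mathcal Cox$, respectively $\mathcal Cox^{op}$, to $\mathbb{Z}$-modules. In both cases the maps $\imath:\Sigma\hookrightarrow\Omega$, $\chi':\Omega\twoheadrightarrow\Sigma^*$, $\chi':\Sigma\twoheadrightarrow\Lambda$ and $\imath:\Lambda\hookrightarrow\Sigma^*$ are natural transformations, the first and last monic and the other two epic, and $\chi'\circ\imath=\imath\circ\chi'$ as maps $\Sigma\to\Sigma^*$. Moreover, for every morphism of $\mathcal Cox$, $\bar\rho$ and $\bar\mu$ on $\Sigma^*$ are the duals of $\mu$ and $\rho$ on $\Sigma$, and $\bar\mu$ and $\bar\rho$ on $\Lambda$ are adjoint with respect to the forms on $\Lambda$. -/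

import Mathlib

open CategoryTheory

universe u

noncomputable section

namespace CoxDescent

/-! ### Lengths, descents and minimal coset representatives

All notions below are relative to a pair `(W, S)` of a group and a set of generators. -/

section Pair

variable {W : Type u} [Group W]

/-- `(W, S)` is a Coxeter system: `W` has a Coxeter presentation on the set `S ⊆ W`. -/
def IsCoxeterSystem (S : Set W) : Prop :=
  ∃ (M : CoxeterMatrix S) (cs : CoxeterSystem M W), ∀ s : S, cs.simple s = s

/-- `ℓ(w)`, the least `k` such that `w` is a product of `k` elements of `S`. -/
def length (S : Set W) (w : W) : ℕ :=
  sInf {k | ∃ l : List W, (∀ s ∈ l, s ∈ S) ∧ l.prod = w ∧ l.length = k}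

/-- The descent set `D(w) = {s ∈ S : ℓ(ws) < ℓ(w)}`. -/
def descents (S : Set W) (w : W) : Set W :=
  {s | s ∈ S ∧ length S (w * s) < length S w}

/-- `W^I = {w : D(w) ⊆ S \ I}`. -/
def leftReps (S I : Set W) : Set W := {w | descents S w ⊆ S \ I}

/-- `^I W = {w : D(w⁻¹) ⊆ S \ I}`. -/
def rightReps (S I : Set W) : Set W := {w | descents S w⁻¹ ⊆ S \ I}

/-- The descent class `D_I(W) = {w : D(w) = I}`. -/
def descentClass (S I : Set W) : Set W := {w | descents S w = I}

/-- `c_{IJ} = #{w : D(w⁻¹) = I, D(w) = J}`. -/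
def descentCount (S I J : Set W) : ℕ :=
  Set.ncard {w | descents S w⁻¹ = I ∧ descents S w = J}

/-- The generating set `I` of `W_I = ⟨I⟩`, as a set of elements of the group `W_I`. -/
def parabolicGens (I : Set W) : Set (Subgroup.closure I) := {x | (x : W) ∈ I}

end Pair

/-! ### The group algebra, the descent algebra, its dual, and `Λ` -/

section Modules

variable {W : Type u} [Group W]

/-- The linear map on the integral group algebra with prescribed values on the group elements. -/
def linearExtend {N : Type*} [AddCommGroup N] (g : W → N) : MonoidAlgebra ℤ W →ₗ[ℤ] N :=
  (MonoidAlgebra.basis W ℤ).constr ℤ g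

theorem linearExtend_of {N : Type*} [AddCommGroup N] (g : W → N) (w : W) :
    linearExtend g (MonoidAlgebra.of ℤ W w) = g w := by
  have h := (MonoidAlgebra.basis W ℤ).constr_basis ℤ g w
  rwa [MonoidAlgebra.basis_apply] at h

/-- The `ℤ`-linear extension of `w ↦ w⁻¹`. -/
def invMap (W : Type u) [Group W] : MonoidAlgebra ℤ W →ₗ[ℤ] MonoidAlgebra ℤ W :=
  linearExtend fun w => MonoidAlgebra.of ℤ W w⁻¹

open scoped Classical in
/-- The form on the group algebra for which the group elements are orthonormal. -/
def groupForm (W : Type u) [Group W] :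
    MonoidAlgebra ℤ W →ₗ[ℤ] MonoidAlgebra ℤ W →ₗ[ℤ] ℤ :=
  linearExtend fun u => linearExtend fun v => if u = v then 1 else 0

variable [Finite W]

/-- The sum in the group algebra of the elements of a subset of `W`. -/
def setSum (A : Set W) : MonoidAlgebra ℤ W :=
  ∑ w ∈ A.toFinite.toFinset, MonoidAlgebra.of ℤ W w

/-- The descent algebra `Σ(W)`: the `ℤ`-span of the descent class sums `D_I(W)`, `I ⊆ S`. -/
def descentAlg (S : Set W) : Submodule ℤ (MonoidAlgebra ℤ W) :=
  Submodule.span ℤ {x | ∃ I ⊆ S, x = setSum (descentClass S I)}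

/-- `D_I(W)` as an element of `Σ(W)`. -/
def descentElt (S I : Set W) (hI : I ⊆ S) : descentAlg S :=
  ⟨setSum (descentClass S I), Submodule.subset_span ⟨I, hI, rfl⟩⟩

/-- The dual module `Σ*(W)`. -/
abbrev DescentDual (S : Set W) : Type u := Module.Dual ℤ (descentAlg S)

/-- `χ : ℤW → Σ*(W)`, dual to the inclusion of `Σ(W)` in the self-dual module `ℤW`. -/
def chi (S : Set W) : MonoidAlgebra ℤ W →ₗ[ℤ] DescentDual S :=
  (descentAlg S).subtype.dualMap ∘ₗ groupForm W

/-- `χ(w)` is the member `D*_{D(w)}` of the basis dual to the descent class sums. -/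
theorem chi_of_descentElt (S I : Set W) (hI : I ⊆ S) (w : W) [Decidable (descents S w = I)] :
    chi S (MonoidAlgebra.of ℤ W w) (descentElt S I hI) = if descents S w = I then 1 else 0 := by
  classical
  simp only [chi, LinearMap.comp_apply, LinearMap.dualMap_apply, Submodule.subtype_apply,
    descentElt, groupForm, setSum, linearExtend_of, map_sum]
  rw [Finset.sum_ite_eq]
  simp [descentClass]

/-- `χ' = χ ∘ ( )⁻¹ : ℤW → Σ*(W)`. -/
def chiInv (S : Set W) : MonoidAlgebra ℤ W →ₗ[ℤ] DescentDual S := chi S ∘ₗ invMap W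

/-- `Λ(W) = χ'(Σ(W))`. -/
def lam (S : Set W) : Submodule ℤ (DescentDual S) := (descentAlg S).map (chiInv S)

/-- `χ' : Σ(W) → Λ(W)`. -/
def chiLam (S : Set W) : descentAlg S →ₗ[ℤ] lam S :=
  (chiInv S).restrict fun _ hx => Submodule.mem_map_of_mem hx

/-- `Λ_I(W) = χ'(D_I(W))`. -/
def lamElt (S I : Set W) (hI : I ⊆ S) : lam S := chiLam S (descentElt S I hI)

/-- `B` is a bilinear form on `Λ(W)` with `⟨Λ_I, Λ_J⟩ = c_{IJ}` for all `I, J ⊆ S`. -/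
def IsLamForm (S : Set W) (B : LinearMap.BilinForm ℤ (lam S)) : Prop :=
  ∀ (I J : Set W) (hI : I ⊆ S) (hJ : J ⊆ S),
    B (lamElt S I hI) (lamElt S J hJ) = (descentCount S I J : ℤ)

end Modules

/-! ### Induced linear maps

A linear map between two modules that restricts to submodules, or descends to quotients, induces
a map there. The definitions below are total, with value zero if there is no induced map. -/

section Induced

variable {A B M N : Type*} [AddCommGroup A] [AddCommGroup B] [AddCommGroup M] [AddCommGroup N]
  [Module ℤ A] [Module ℤ B] [Module ℤ M] [Module ℤ N]

open scoped Classical in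
/-- The map `g'` with `j ∘ g' = g ∘ i`, for injections `i` and `j`, if there is one. -/
def restrictAlong (i : A →ₗ[ℤ] M) (j : B →ₗ[ℤ] N) (g : M →ₗ[ℤ] N) : A →ₗ[ℤ] B :=
  if h : ∃ g' : A →ₗ[ℤ] B, j ∘ₗ g' = g ∘ₗ i then h.choose else 0

open scoped Classical in
/-- The map `g'` with `g' ∘ p = q ∘ g`, for surjections `p` and `q`, if there is one. -/
def descendAlong (p : M →ₗ[ℤ] A) (q : N →ₗ[ℤ] B) (g : M →ₗ[ℤ] N) : A →ₗ[ℤ] B :=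
  if h : ∃ g' : A →ₗ[ℤ] B, g' ∘ₗ p = q ∘ₗ g then h.choose else 0

end Induced

/-! ### The maps `μ`, `ρ`, `μ̄`, `ρ̄`

Here `f : V → W` is an embedding of `(V, T)` in `(W, S)`, which identifies `(V, T)` with
`(W_I, I)` for `I = f(T)`. For `I ⊆ S` itself one takes `V = W_I`, `T = I` and the inclusion. -/

section Maps

variable {V W : Type u} [Group V] [Group W]

/-- `w_I ∈ W_I`, where `w = w_I · z` with `z ∈ ^I W`. -/
def leftFactor (f : V →* W) (T : Set V) (S : Set W) (w : W) : V :=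
  Classical.epsilon fun x => ∃ z ∈ rightReps S (f '' T), w = f x * z

/-- `_I w ∈ W_I`, where `w = z · _I w` with `z ∈ W^I`. -/
def rightFactor (f : V →* W) (T : Set V) (S : Set W) (w : W) : V :=
  Classical.epsilon fun x => ∃ z ∈ leftReps S (f '' T), w = z * f x

/-- `ρ : ℤW → ℤW_I`, `w ↦ w_I`. -/
def rho (f : V →* W) (T : Set V) (S : Set W) : MonoidAlgebra ℤ W →ₗ[ℤ] MonoidAlgebra ℤ V :=
  linearExtend fun w => MonoidAlgebra.of ℤ V (leftFactor f T S w)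

/-- `ρ̄ : ℤW → ℤW_I`, `w ↦ _I w`. -/
def rhoBar (f : V →* W) (T : Set V) (S : Set W) :
    MonoidAlgebra ℤ W →ₗ[ℤ] MonoidAlgebra ℤ V :=
  linearExtend fun w => MonoidAlgebra.of ℤ V (rightFactor f T S w)

variable [Finite W]

/-- `μ : ℤW_I → ℤW`, `u ↦ W^I · u`. -/
def mu (f : V →* W) (T : Set V) (S : Set W) : MonoidAlgebra ℤ V →ₗ[ℤ] MonoidAlgebra ℤ W :=
  linearExtend fun x => setSum (leftReps S (f '' T)) * MonoidAlgebra.of ℤ W (f x)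

/-- `μ̄ : ℤW_I → ℤW`, `u ↦ u · ^I W`. -/
def muBar (f : V →* W) (T : Set V) (S : Set W) :
    MonoidAlgebra ℤ V →ₗ[ℤ] MonoidAlgebra ℤ W :=
  linearExtend fun x => MonoidAlgebra.of ℤ W (f x) * setSum (rightReps S (f '' T))

variable [Finite V]

/-- `μ : Σ(W_I) → Σ(W)`, the restriction of `μ`. -/
def muSigma (f : V →* W) (T : Set V) (S : Set W) : descentAlg T →ₗ[ℤ] descentAlg S :=
  restrictAlong (descentAlg T).subtype (descentAlg S).subtype (mu f T S)

/-- `ρ : Σ(W) → Σ(W_I)`, the restriction of `ρ`. -/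
def rhoSigma (f : V →* W) (T : Set V) (S : Set W) : descentAlg S →ₗ[ℤ] descentAlg T :=
  restrictAlong (descentAlg S).subtype (descentAlg T).subtype (rho f T S)

/-- `μ̄ : Σ*(W_I) → Σ*(W)`, to which `μ̄` descends along `χ`. -/
def muBarDual (f : V →* W) (T : Set V) (S : Set W) : DescentDual T →ₗ[ℤ] DescentDual S :=
  descendAlong (chi T) (chi S) (muBar f T S)

/-- `ρ̄ : Σ*(W) → Σ*(W_I)`, to which `ρ̄` descends along `χ`. -/
def rhoBarDual (f : V →* W) (T : Set V) (S : Set W) : DescentDual S →ₗ[ℤ] DescentDual T :=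
  descendAlong (chi S) (chi T) (rhoBar f T S)

/-- `μ̄ : Λ(W_I) → Λ(W)`, the restriction of `μ̄ : Σ*(W_I) → Σ*(W)`. -/
def muBarLam (f : V →* W) (T : Set V) (S : Set W) : lam T →ₗ[ℤ] lam S :=
  restrictAlong (lam T).subtype (lam S).subtype (muBarDual f T S)

/-- `ρ̄ : Λ(W) → Λ(W_I)`, the restriction of `ρ̄ : Σ*(W) → Σ*(W_I)`. -/
def rhoBarLam (f : V →* W) (T : Set V) (S : Set W) : lam S →ₗ[ℤ] lam T :=
  restrictAlong (lam S).subtype (lam T).subtype (rhoBarDual f T S)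

end Maps

/-! ### The category of finite Coxeter systems -/

/-- A finite Coxeter system `(W, S)`. -/
structure Cox : Type (u + 1) where
  W : Type u
  [group : Group W]
  [finite : Finite W]
  S : Set W
  isCoxeterSystem : IsCoxeterSystem S

attribute [instance] Cox.group Cox.finite

/-- An embedding of Coxeter systems: an injective group homomorphism that carries the
generators of the source to generators of the target. -/
@[ext]
structure Cox.Hom (X Y : Cox.{u}) : Type u where
  hom : X.W →* Y.W
  injective : Function.Injective hom
  map_gen : ∀ s ∈ X.S, hom s ∈ Y.S

instance : Category.{u} Cox.{u} where
  Hom X Y := Cox.Hom X Y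
  id X := ⟨MonoidHom.id X.W, fun _ _ h => h, fun _ h => h⟩
  comp f g := ⟨g.hom.comp f.hom, fun _ _ h => f.injective (g.injective h),
    fun s h => g.map_gen _ (f.map_gen s h)⟩

/-- The assignment on objects and morphisms respects identities and compositions. -/
def IsFunctorial {C D : Type*} [Category C] [Category D] (P : C ⥤q D) : Prop :=
  (∀ X : C, P.map (𝟙 X) = 𝟙 (P.obj X)) ∧
  ∀ {X Y Z : C} (f : X ⟶ Y) (g : Y ⟶ Z), P.map (f ≫ g) = P.map f ≫ P.map g

/-- The functor with the given values on objects and morphisms. -/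
def toFunctor {C D : Type*} [Category C] [Category D] (P : C ⥤q D) (h : IsFunctorial P) :
    C ⥤ D where
  obj := P.obj
  map f := P.map f
  map_id := h.1
  map_comp := h.2

/-- `Ω` on the category of finite Coxeter systems: group algebras and the maps `μ`. -/
def Omega : Cox.{u} ⥤q ModuleCat.{u} ℤ where
  obj X := ModuleCat.of ℤ (MonoidAlgebra ℤ X.W)
  map {X Y} f := ModuleCat.ofHom (mu (Cox.Hom.hom f) X.S Y.S)

/-- `Ω` on the opposite category: group algebras and the maps `ρ`. -/
def OmegaOp : Cox.{u}ᵒᵖ ⥤q ModuleCat.{u} ℤ where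
  obj X := ModuleCat.of ℤ (MonoidAlgebra ℤ X.unop.W)
  map {X Y} f := ModuleCat.ofHom (rho (Cox.Hom.hom f.unop) Y.unop.S X.unop.S)

/-- `Σ` on the category of finite Coxeter systems: descent algebras and the maps `μ`. -/
def Sigma : Cox.{u} ⥤q ModuleCat.{u} ℤ where
  obj X := ModuleCat.of ℤ (descentAlg X.S)
  map {X Y} f := ModuleCat.ofHom (muSigma (Cox.Hom.hom f) X.S Y.S)

/-- `Σ` on the opposite category: descent algebras and the maps `ρ`. -/
def SigmaOp : Cox.{u}ᵒᵖ ⥤q ModuleCat.{u} ℤ where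
  obj X := ModuleCat.of ℤ (descentAlg X.unop.S)
  map {X Y} f := ModuleCat.ofHom (rhoSigma (Cox.Hom.hom f.unop) Y.unop.S X.unop.S)

/-- `Σ*` on the category of finite Coxeter systems: dual modules and the maps `μ̄`. -/
def SigmaDual : Cox.{u} ⥤q ModuleCat.{u} ℤ where
  obj X := ModuleCat.of ℤ (DescentDual X.S)
  map {X Y} f := ModuleCat.ofHom (muBarDual (Cox.Hom.hom f) X.S Y.S)

/-- `Σ*` on the opposite category: dual modules and the maps `ρ̄`. -/
def SigmaDualOp : Cox.{u}ᵒᵖ ⥤q ModuleCat.{u} ℤ where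
  obj X := ModuleCat.of ℤ (DescentDual X.unop.S)
  map {X Y} f := ModuleCat.ofHom (rhoBarDual (Cox.Hom.hom f.unop) Y.unop.S X.unop.S)

/-- `Λ` on the category of finite Coxeter systems, with the maps `μ̄`. -/
def Lambda : Cox.{u} ⥤q ModuleCat.{u} ℤ where
  obj X := ModuleCat.of ℤ (lam X.S)
  map {X Y} f := ModuleCat.ofHom (muBarLam (Cox.Hom.hom f) X.S Y.S)

/-- `Λ` on the opposite category, with the maps `ρ̄`. -/
def LambdaOp : Cox.{u}ᵒᵖ ⥤q ModuleCat.{u} ℤ where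
  obj X := ModuleCat.of ℤ (lam X.unop.S)
  map {X Y} f := ModuleCat.ofHom (rhoBarLam (Cox.Hom.hom f.unop) Y.unop.S X.unop.S)

end CoxDescent

end

/-! Let `f` identify `(V, T)` with a parabolic subgroup of `(W, S)`. For the forms on the group
algebras, `ρ̄` is the transpose of `μ` and `ρ` is the transpose of `μ̄`, because `_I w = x` if and
only if `w x⁻¹` lies in `W^I`. An element of the group algebra lies in `Σ` exactly if its
coefficients are constant on descent classes. Thus `μ` preserves `Σ`, since the descent set of
`_I w` is `D(w) ∩ I`, and so does `ρ`, since by Deodhar's lemma the descent set of `x y`, with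
`x ∈ W_I` and `y ∈ ^I W`, depends on `x` through its descents only. Transposing, `ρ̄` and `μ̄`
descend to the duals of `μ` and `ρ` on `Σ*`, and inversion exchanges `μ` with `μ̄` and `ρ` with
`ρ̄`, which gives their action on `Λ = χ'(Σ)`. The form on `Λ` is `⟨χ'(x), y⟩ = y(x)`; it is well
defined because `χ'(x)(y)` is symmetric in `x` and `y`.

Functoriality has to be checked only on `Ω`, where it follows from `_J(_I w) = _J w` for `J ⊆ I`:
it passes to `Σ` and `Λ` along monomorphisms and to `Σ*` along an epimorphism. -/

noncomputable section

namespace CoxDescent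

/-! ### The exchange condition -/

section Exchange

open CoxeterSystem

variable {B W : Type*} [Group W] {M : CoxeterMatrix B} (cs : CoxeterSystem M W)

theorem prod_map_reverse_alternatingWord {N : Type*} [Monoid N] (g : B → N) (i j : B) (n : ℕ) :
    ((alternatingWord i j (2 * n)).reverse.map g).prod = (g j * g i) ^ n := by
  induction n with
  | zero => simp [alternatingWord]
  | succ n ih =>
    rw [mul_add, mul_one, alternatingWord_succ, alternatingWord_succ, List.concat_eq_append,
      List.concat_eq_append, List.reverse_append, List.reverse_append]
    simp only [List.reverse_singleton, List.singleton_append, List.map_cons, List.prod_cons, ih,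
      pow_succ', mul_assoc]

theorem leftInvSeq_alternatingWord (i j : B) (n : ℕ) :
    cs.leftInvSeq (alternatingWord i j (2 * n)) =
      (List.range (2 * n)).map fun k => cs.simple i * (cs.simple j * cs.simple i) ^ k := by
  refine List.ext_getElem (by simp) fun k hk _ => ?_
  rw [length_leftInvSeq, length_alternatingWord] at hk
  rw [cs.getElem_leftInvSeq_alternatingWord i j n k hk, prod_alternatingWord_eq_mul_pow,
    List.getElem_map, List.getElem_range, if_neg (by simp), Nat.mul_add_div two_pos]
  rfl

open scoped Classical in
theorem even_count_leftInvSeq_alternatingWord (i j : B) (t : W) :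
    Even ((cs.leftInvSeq (alternatingWord i j (2 * M j i))).count t) := by
  rw [leftInvSeq_alternatingWord, two_mul, List.range_add, List.map_append, List.map_map,
    List.count_append]
  simp [Function.comp_def, pow_add]

open scoped Classical in
/-- The action of a simple reflection `s` on signed elements: conjugation by `s`, with a change
of sign at `s` itself. -/
def signedConj (i : B) : Function.End (W × ZMod 2) := fun p =>
  (cs.simple i * p.1 * cs.simple i, p.2 + if p.1 = cs.simple i then 1 else 0)

open scoped Classical in
theorem prod_map_signedConj_apply (ω : List B) (t : W) (e : ZMod 2) :
    (ω.map (signedConj cs)).prod (t, e) =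
      (cs.wordProd ω * t * (cs.wordProd ω)⁻¹, e + (cs.rightInvSeq ω).count t) := by
  induction ω with
  | nil => simp [Function.End.one_def]
  | cons i ω ih =>
    have hcond : cs.wordProd ω * t * (cs.wordProd ω)⁻¹ = cs.simple i ↔
        (cs.wordProd ω)⁻¹ * cs.simple i * cs.wordProd ω = t := by
      rw [mul_inv_eq_iff_eq_mul, ← eq_inv_mul_iff_mul_eq, ← mul_assoc, eq_comm]
    rw [List.map_cons, List.prod_cons]
    change signedConj cs i ((ω.map (signedConj cs)).prod (t, e)) = _
    rw [ih]
    refine Prod.ext ?_ ?_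
    · simp [signedConj, wordProd_cons, mul_assoc]
    · simp [signedConj, rightInvSeq, List.count_cons, hcond, add_assoc]

theorem signedConj_isLiftable : M.IsLiftable (signedConj cs) := by
  classical
  intro j i
  have hone : cs.wordProd (alternatingWord i j (2 * M j i)).reverse = 1 := by
    rw [wordProd, prod_map_reverse_alternatingWord, cs.simple_mul_simple_pow]
  funext p
  rw [← prod_map_reverse_alternatingWord, prod_map_signedConj_apply, hone, rightInvSeq_reverse,
    List.count_reverse, (ZMod.natCast_eq_zero_iff_even).2
      (even_count_leftInvSeq_alternatingWord cs i j p.1)]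
  simp [Function.End.one_def]

/-- The action of a Coxeter group on its signed elements. -/
def signedAction : W →* Function.End (W × ZMod 2) :=
  cs.lift ⟨signedConj cs, signedConj_isLiftable cs⟩

theorem signedAction_simple (i : B) : signedAction cs (cs.simple i) = signedConj cs i :=
  cs.lift_apply_simple (signedConj_isLiftable cs) i

theorem signedAction_mul_apply (v w : W) (p : W × ZMod 2) :
    signedAction cs (v * w) p = signedAction cs v (signedAction cs w p) := by
  rw [map_mul]; rfl

open scoped Classical in
theorem signedAction_wordProd_apply (ω : List B) (t : W) (e : ZMod 2) :
    signedAction cs (cs.wordProd ω) (t, e) =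
      (cs.wordProd ω * t * (cs.wordProd ω)⁻¹, e + (cs.rightInvSeq ω).count t) := by
  rw [← prod_map_signedConj_apply, wordProd, map_list_prod, List.map_map]
  simp only [Function.comp_def, signedAction_simple]

theorem signedAction_reflection_apply {t : W} (ht : cs.IsReflection t) (e : ZMod 2) :
    signedAction cs t (t, e) = (t, e + 1) := by
  classical
  obtain ⟨u, i, rfl⟩ := ht
  obtain ⟨ω, rfl⟩ := cs.wordProd_surjective u
  set u := cs.wordProd ω
  set c := (((cs.rightInvSeq ω).count (cs.simple i) : ℕ) : ZMod 2)
  have hu (e : ZMod 2) :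
      signedAction cs u (cs.simple i, e) = (u * cs.simple i * u⁻¹, e + c) :=
    signedAction_wordProd_apply cs ω _ e
  have hu' : signedAction cs u⁻¹ (u * cs.simple i * u⁻¹, e) = (cs.simple i, e - c) := by
    rw [← sub_add_cancel e c, ← hu, ← signedAction_mul_apply, inv_mul_cancel, map_one,
      add_sub_cancel_right]
    rfl
  rw [signedAction_mul_apply, hu', signedAction_mul_apply, signedAction_simple]
  have hi : signedConj cs i (cs.simple i, e - c) = (cs.simple i, e - c + 1) := by
    simp [signedConj]
  rw [hi, hu, sub_add_eq_add_sub, sub_add_cancel]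

/- Acting by `w` and by `wt` on `(t, 0)` gives opposite signs, while `t` does not occur among the
inversions of a reduced word for `wt`. -/
theorem mem_rightInvSeq_of_isRightInversion {ω : List B} {t : W}
    (h : cs.IsRightInversion (cs.wordProd ω) t) : t ∈ cs.rightInvSeq ω := by
  classical
  obtain ⟨ht, hlt⟩ := h
  obtain ⟨ω', hred, hω'⟩ := cs.exists_isReduced (cs.wordProd ω * t)
  have hmul : cs.wordProd ω' * t = cs.wordProd ω := by rw [← hω', mul_assoc, ht.mul_self, mul_one]
  have hnot : t ∉ cs.rightInvSeq ω' := fun hmem => by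
    have hlt' := (cs.isRightInversion_of_mem_rightInvSeq hred hmem).2
    rw [hmul, ← hω'] at hlt'
    exact hlt.not_gt hlt'
  by_contra hmem
  have hsign := signedAction_mul_apply cs (cs.wordProd ω') t (t, 0)
  rw [hmul, signedAction_reflection_apply cs ht, signedAction_wordProd_apply,
    signedAction_wordProd_apply, List.count_eq_zero_of_not_mem hmem,
    List.count_eq_zero_of_not_mem hnot] at hsign
  simpa using congrArg Prod.snd hsign

theorem exists_eraseIdx_of_isRightInversion {ω : List B} {t : W}
    (h : cs.IsRightInversion (cs.wordProd ω) t) :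
    ∃ k < ω.length, cs.wordProd ω * t = cs.wordProd (ω.eraseIdx k) := by
  obtain ⟨k, hk, rfl⟩ := List.mem_iff_getElem.1 (mem_rightInvSeq_of_isRightInversion cs h)
  refine ⟨k, by simpa using hk, ?_⟩
  rw [← cs.wordProd_mul_getD_rightInvSeq, List.getD_eq_getElem _ _ hk]

end Exchange

/-! ### Lengths with respect to generating sets of involutions -/

section Length

variable {W : Type*} [Group W] {S : Set W}

/-- `S` generates `W` and consists of involutions (or trivial elements). -/
structure IsInvolutiveGen (S : Set W) : Prop where
  mul_self : ∀ s ∈ S, s * s = 1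
  closure_eq : Subgroup.closure S = ⊤

theorem length_prod_le {l : List W} (hl : ∀ s ∈ l, s ∈ S) : length S l.prod ≤ l.length :=
  Nat.sInf_le ⟨l, hl, rfl, rfl⟩

theorem length_prod_eraseIdx_lt {l : List W} (hl : ∀ s ∈ l, s ∈ S) {k : ℕ} (hk : k < l.length) :
    length S (l.eraseIdx k).prod < l.length :=
  (length_prod_le fun s hs => hl s (List.mem_of_mem_eraseIdx hs)).trans_lt (by
    have := List.length_eraseIdx_add_one hk
    omega)

theorem length_one : length S (1 : W) = 0 := by
  simpa using length_prod_le (S := S) (l := []) (by simp)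

theorem length_le_one {s : W} (hs : s ∈ S) : length S s ≤ 1 := by
  simpa using length_prod_le (S := S) (l := [s]) (by simpa using hs)

namespace IsInvolutiveGen

variable (hS : IsInvolutiveGen S)
include hS

theorem inv_eq {s : W} (hs : s ∈ S) : s⁻¹ = s := inv_eq_of_mul_eq_one_left (hS.mul_self s hs)

theorem exists_reduced (w : W) :
    ∃ l : List W, (∀ s ∈ l, s ∈ S) ∧ l.prod = w ∧ l.length = length S w := by
  have hmem : w ∈ (Subgroup.closure S).toSubmonoid := hS.closure_eq ▸ Subgroup.mem_top w
  rw [Subgroup.closure_toSubmonoid] at hmem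
  obtain ⟨l, hl, hw⟩ := Submonoid.exists_list_of_mem_closure hmem
  have hlS : ∀ s ∈ l, s ∈ S := fun s hs => (hl s hs).elim id fun h => by
    rwa [← inv_inv s, hS.inv_eq h]
  exact Nat.sInf_mem (s := {k | ∃ l : List W, (∀ s ∈ l, s ∈ S) ∧ l.prod = w ∧ l.length = k})
    ⟨_, l, hlS, hw, rfl⟩

theorem length_mul_le (v w : W) : length S (v * w) ≤ length S v + length S w := by
  obtain ⟨l, hl, rfl, hl'⟩ := hS.exists_reduced v
  obtain ⟨m, hm, rfl, hm'⟩ := hS.exists_reduced w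
  rw [← hl', ← hm', ← List.prod_append, ← List.length_append]
  exact length_prod_le fun s hs => (List.mem_append.1 hs).elim (hl s) (hm s)

theorem length_inv_le (w : W) : length S w⁻¹ ≤ length S w := by
  obtain ⟨l, hl, rfl, hl'⟩ := hS.exists_reduced w
  have hinv : l.map (fun s => s⁻¹) = l :=
    (List.map_congr_left fun s hs => hS.inv_eq (hl s hs)).trans (List.map_id' l)
  rw [← hl', List.prod_inv_reverse, hinv, ← List.length_reverse]
  exact length_prod_le fun s hs => hl s (List.mem_reverse.1 hs)

theorem length_inv (w : W) : length S w⁻¹ = length S w :=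
  le_antisymm (hS.length_inv_le w) (by simpa using hS.length_inv_le w⁻¹)

theorem eq_one_of_length_eq_zero {w : W} (hw : length S w = 0) : w = 1 := by
  obtain ⟨l, -, rfl, hl⟩ := hS.exists_reduced w
  rw [hw, List.length_eq_zero_iff] at hl
  rw [hl, List.prod_nil]

theorem length_mul_le_add_one (w : W) {s : W} (hs : s ∈ S) :
    length S (w * s) ≤ length S w + 1 :=
  (hS.length_mul_le w s).trans (Nat.add_le_add_left (length_le_one hs) _)

theorem length_le_mul_add_one (w : W) {s : W} (hs : s ∈ S) :
    length S w ≤ length S (w * s) + 1 := by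
  simpa [mul_assoc, hS.mul_self s hs] using hS.length_mul_le_add_one (w * s) hs

theorem length_mul_left_eq (w : W) {s : W} (hs : s ∈ S) :
    length S (s * w) = length S (w⁻¹ * s) := by
  rw [← hS.length_inv, mul_inv_rev, hS.inv_eq hs]

theorem nonempty_descents {w : W} (hw : w ≠ 1) : (descents S w).Nonempty := by
  obtain ⟨l, hl, rfl, hlen⟩ := hS.exists_reduced w
  obtain ⟨m, s, rfl⟩ := (List.eq_nil_or_concat' l).resolve_left fun hnil => hw (by simp [hnil])
  have hs : s ∈ S := hl s (by simp)
  have hle : length S m.prod ≤ m.length := length_prod_le fun t ht => hl t (by simp [ht])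
  refine ⟨s, hs, ?_⟩
  rw [← hlen, List.prod_append, List.prod_singleton, mul_assoc, hS.mul_self s hs, mul_one,
    List.length_append, List.length_singleton]
  exact Nat.lt_succ_of_le hle

end IsInvolutiveGen

theorem wordProd_eq_prod_map_val {M : CoxeterMatrix S} {cs : CoxeterSystem M W}
    (hcs : ∀ s : S, cs.simple s = s) (ω : List S) :
    cs.wordProd ω = (ω.map Subtype.val).prod := by
  rw [CoxeterSystem.wordProd, funext hcs]

namespace IsCoxeterSystem

theorem involutiveGen (hS : IsCoxeterSystem S) : IsInvolutiveGen S := by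
  obtain ⟨M, cs, hcs⟩ := hS
  refine ⟨fun s hs => by simpa [hcs] using cs.simple_mul_simple_self ⟨s, hs⟩, ?_⟩
  rw [← cs.subgroup_closure_range_simple, funext hcs, Subtype.range_coe]

theorem length_eq {M : CoxeterMatrix S} {cs : CoxeterSystem M W} (hcs : ∀ s : S, cs.simple s = s)
    (w : W) : length S w = cs.length w := by
  apply le_antisymm
  · obtain ⟨ω, hred, rfl⟩ := cs.exists_isReduced w
    rw [hred.eq, wordProd_eq_prod_map_val hcs, ← List.length_map (as := ω) (f := Subtype.val)]
    exact length_prod_le (by simp +contextual)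
  · obtain ⟨l, hl, rfl, hlen⟩ := (involutiveGen ⟨M, cs, hcs⟩).exists_reduced w
    lift l to List S using hl
    rw [← hlen, ← wordProd_eq_prod_map_val hcs, List.length_map]
    exact cs.length_wordProd_le l

variable (hS : IsCoxeterSystem S)
include hS

theorem length_mul_ne (w : W) {s : W} (hs : s ∈ S) : length S (w * s) ≠ length S w := by
  obtain ⟨M, cs, hcs⟩ := hS
  rw [length_eq hcs, length_eq hcs]
  simpa [hcs] using cs.length_mul_simple_ne w ⟨s, hs⟩

theorem exchange {l : List W} (hl : ∀ s ∈ l, s ∈ S) {s : W} (hs : s ∈ S)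
    (h : length S (l.prod * s) < length S l.prod) :
    ∃ k < l.length, l.prod * s = (l.eraseIdx k).prod := by
  obtain ⟨M, cs, hcs⟩ := hS
  lift l to List S using hl
  lift s to S using hs
  rw [length_eq hcs, length_eq hcs, ← wordProd_eq_prod_map_val hcs, ← hcs s] at h
  obtain ⟨k, hk, hkl⟩ :=
    exists_eraseIdx_of_isRightInversion cs ⟨cs.isReflection_simple s, h⟩
  refine ⟨k, by simpa using hk, ?_⟩
  rw [List.eraseIdx_map, ← wordProd_eq_prod_map_val hcs, ← wordProd_eq_prod_map_val hcs, ← hkl,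
    hcs]

theorem exchange_mul (v : W) {l : List W} (hl : ∀ s ∈ l, s ∈ S) {s : W} (hs : s ∈ S)
    (h : length S (v * l.prod * s) < length S (v * l.prod)) :
    (∃ v', length S v' < length S v ∧ v * l.prod * s = v' * l.prod) ∨
      ∃ k < l.length, l.prod * s = (l.eraseIdx k).prod := by
  obtain ⟨a, ha, rfl, hlen⟩ := hS.involutiveGen.exists_reduced v
  rw [← List.prod_append] at h ⊢
  obtain ⟨k, hk, hkl⟩ :=
    hS.exchange (fun r hr => (List.mem_append.1 hr).elim (ha r) (hl r)) hs h
  rcases lt_or_ge k a.length with hka | hka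
  · refine Or.inl ⟨(a.eraseIdx k).prod, hlen ▸ length_prod_eraseIdx_lt ha hka, ?_⟩
    rw [hkl, List.eraseIdx_append_of_lt_length hka, List.prod_append]
  · rw [List.eraseIdx_append_of_length_le hka, List.prod_append, List.prod_append, mul_assoc,
      mul_left_cancel_iff] at hkl
    rw [List.length_append] at hk
    exact Or.inr ⟨k - a.length, by omega, hkl⟩

end IsCoxeterSystem

end Length

/-! ### Parabolic factorizations -/

section Parabolic

variable {V W : Type u} [Group V] [Group W]

theorem mem_rightReps_iff_inv_mem {S I : Set W} {y : W} :
    y ∈ rightReps S I ↔ y⁻¹ ∈ leftReps S I := Iff.rfl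

/-- `f` identifies the group `V`, generated by `T`, with a parabolic subgroup of the Coxeter
system `(W, S)`. -/
structure IsParabolicEmbedding (f : V →* W) (T : Set V) (S : Set W) : Prop where
  injective : Function.Injective f
  map_gen : ∀ t ∈ T, f t ∈ S
  closure_eq : Subgroup.closure T = ⊤
  isCoxeterSystem : IsCoxeterSystem S

namespace IsParabolicEmbedding

variable {f : V →* W} {T : Set V} {S : Set W}

theorem exists_minimal_factor (f : V →* W) (S : Set W) (w : W) :
    ∃ x z, (∀ y, length S z ≤ length S (z * f y)) ∧ w = z * f x := by
  obtain ⟨x, hx⟩ := Nat.sInf_mem (Set.range_nonempty fun x : V => length S (w * f x))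
  refine ⟨x⁻¹, w * f x, fun y => ?_, by simp⟩
  change length S (w * f x) = _ at hx
  rw [hx, mul_assoc, ← map_mul]
  exact Nat.sInf_le ⟨x * y, rfl⟩

variable (h : IsParabolicEmbedding f T S)
include h

theorem involutiveGen : IsInvolutiveGen S := h.isCoxeterSystem.involutiveGen

theorem source_involutiveGen : IsInvolutiveGen T where
  mul_self t ht := h.injective (by
    rw [map_mul, map_one, h.involutiveGen.mul_self _ (h.map_gen t ht)])
  closure_eq := h.closure_eq

theorem mem_leftReps_iff {z : W} :
    z ∈ leftReps S (f '' T) ↔ ∀ t ∈ T, length S z < length S (z * f t) := by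
  constructor
  · intro hz t ht
    by_contra hlt
    exact (hz ⟨h.map_gen t ht, lt_of_le_of_ne (not_lt.1 hlt)
      (h.isCoxeterSystem.length_mul_ne z (h.map_gen t ht))⟩).2 ⟨t, ht, rfl⟩
  · rintro hz s ⟨hs, hlt⟩
    refine ⟨hs, ?_⟩
    rintro ⟨t, ht, rfl⟩
    exact (hz t ht).not_gt hlt

theorem mem_rightReps_iff {y : W} :
    y ∈ rightReps S (f '' T) ↔ ∀ t ∈ T, length S y < length S (f t * y) := by
  rw [mem_rightReps_iff_inv_mem, h.mem_leftReps_iff, h.involutiveGen.length_inv]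
  exact forall₂_congr fun t ht => by rw [h.involutiveGen.length_mul_left_eq y (h.map_gen t ht)]

/- If appending the last letter of `l` to a word for `z * f l.prod` shortened it, the exchanged
letter would lie either in `z`, against the minimality of `z`, or in `l`, which is reduced. -/
theorem length_mul_prod_of_minimal {z : W} (hz : ∀ y, length S z ≤ length S (z * f y))
    (l : List V) (hl : ∀ t ∈ l, t ∈ T) (hred : length T l.prod = l.length) :
    length S (z * f l.prod) = length S z + l.length := by
  induction l using List.reverseRecOn with
  | nil => simp
  | append_singleton m t ih =>
    have hm : ∀ r ∈ m, r ∈ T := fun r hr => hl r (by simp [hr])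
    have ht : t ∈ T := hl t (by simp)
    rw [List.prod_append, List.prod_singleton, List.length_append, List.length_singleton] at *
    have hmred : length T m.prod = m.length := by
      have hle := length_prod_le hm
      have hadd := h.source_involutiveGen.length_mul_le_add_one m.prod ht
      omega
    specialize ih hm hmred
    have hgrow : ¬ length S (z * f m.prod * f t) < length S (z * f m.prod) := fun hlt => by
      rw [map_list_prod] at hlt
      have hfm : ∀ s ∈ m.map f, s ∈ S :=
        List.forall_mem_map.2 fun r hr => h.map_gen r (hm r hr)
      rcases h.isCoxeterSystem.exchange_mul z hfm (h.map_gen t ht) hlt with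
        ⟨z', hz', heq⟩ | ⟨k, hk, heq⟩
      · refine (hz (m.prod * t * m.prod⁻¹)).not_gt ?_
        rwa [map_mul, map_mul, map_inv, ← mul_assoc, ← mul_assoc, map_list_prod, heq,
          mul_inv_cancel_right]
      · rw [List.eraseIdx_map, ← map_list_prod, ← map_list_prod, ← map_mul] at heq
        have hlt' := length_prod_eraseIdx_lt hm (by simpa using hk)
        rw [← h.injective heq] at hlt'
        omega
    have hle := h.involutiveGen.length_mul_le_add_one (z * f m.prod) (h.map_gen t ht)
    have hne := h.isCoxeterSystem.length_mul_ne (z * f m.prod) (h.map_gen t ht)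
    rw [map_mul, ← mul_assoc]
    omega

theorem length_mul_of_minimal {z : W} (hz : ∀ y, length S z ≤ length S (z * f y)) (x : V) :
    length S (z * f x) = length S z + length T x := by
  obtain ⟨l, hl, rfl, hlen⟩ := h.source_involutiveGen.exists_reduced x
  rw [h.length_mul_prod_of_minimal hz l hl hlen.symm, hlen]

theorem length_mul {z : W} (hz : z ∈ leftReps S (f '' T)) (x : V) :
    length S (z * f x) = length S z + length T x := by
  obtain ⟨y, z₀, hmin, rfl⟩ := exists_minimal_factor f S z
  obtain rfl : y = 1 := by
    by_contra hy
    obtain ⟨t, ht, hlt⟩ := h.source_involutiveGen.nonempty_descents hy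
    have hup := h.mem_leftReps_iff.1 hz t ht
    rw [mul_assoc, ← map_mul, h.length_mul_of_minimal hmin, h.length_mul_of_minimal hmin] at hup
    omega
  rw [map_one, mul_one]
  exact h.length_mul_of_minimal hmin x

theorem length_mul_rightReps {y : W} (hy : y ∈ rightReps S (f '' T)) (x : V) :
    length S (f x * y) = length T x + length S y := by
  rw [← h.involutiveGen.length_inv, mul_inv_rev, ← map_inv, h.length_mul hy,
    h.involutiveGen.length_inv, h.source_involutiveGen.length_inv, add_comm]

theorem factor_unique {z z' : W} (hz : z ∈ leftReps S (f '' T)) (hz' : z' ∈ leftReps S (f '' T))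
    {x x' : V} (hx : z * f x = z' * f x') : x = x' := by
  have hz_eq : z = z' * f (x' * x⁻¹) := by
    rw [map_mul, map_inv, ← mul_assoc, ← hx, mul_inv_cancel_right]
  have hz'_eq : z' = z * f (x * x'⁻¹) := by
    rw [map_mul, map_inv, ← mul_assoc, hx, mul_inv_cancel_right]
  have hlen := h.length_mul hz' (x' * x⁻¹)
  have hlen' := h.length_mul hz (x * x'⁻¹)
  rw [← hz_eq] at hlen
  rw [← hz'_eq] at hlen'
  exact mul_inv_eq_one.1 (h.source_involutiveGen.eq_one_of_length_eq_zero (by omega))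

theorem rightFactor_mul {z : W} (hz : z ∈ leftReps S (f '' T)) (x : V) :
    rightFactor f T S (z * f x) = x := by
  obtain ⟨z', hz', heq⟩ := Classical.epsilon_spec
    (p := fun y => ∃ z' ∈ leftReps S (f '' T), z * f x = z' * f y) ⟨x, z, hz, rfl⟩
  exact h.factor_unique hz' hz heq.symm

theorem leftFactor_mul {y : W} (hy : y ∈ rightReps S (f '' T)) (x : V) :
    leftFactor f T S (f x * y) = x := by
  obtain ⟨y', hy', heq⟩ := Classical.epsilon_spec
    (p := fun v => ∃ y' ∈ rightReps S (f '' T), f x * y = f v * y') ⟨x, y, hy, rfl⟩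
  have heq_inv := congrArg Inv.inv heq
  rw [mul_inv_rev, mul_inv_rev, ← map_inv, ← map_inv] at heq_inv
  exact inv_injective (h.factor_unique hy' hy heq_inv.symm)

theorem exists_mul_rightFactor (w : W) :
    ∃ z ∈ leftReps S (f '' T), w = z * f (rightFactor f T S w) := by
  obtain ⟨x, z, hmin, hw⟩ := exists_minimal_factor f S w
  exact Classical.epsilon_spec (p := fun x => ∃ z ∈ leftReps S (f '' T), w = z * f x)
    ⟨x, z, h.mem_leftReps_iff.2 fun t ht => (hmin t).lt_of_ne
      (h.isCoxeterSystem.length_mul_ne z (h.map_gen t ht)).symm, hw⟩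

theorem leftFactor_eq_inv (w : W) : leftFactor f T S w = (rightFactor f T S w⁻¹)⁻¹ := by
  obtain ⟨z, hz, hw⟩ := h.exists_mul_rightFactor w⁻¹
  have hz' : z⁻¹ ∈ rightReps S (f '' T) := by rwa [mem_rightReps_iff_inv_mem, inv_inv]
  rw [← h.leftFactor_mul hz' (rightFactor f T S w⁻¹)⁻¹, map_inv, ← mul_inv_rev, ← hw, inv_inv]

theorem rightFactor_eq_iff {w : W} {x : V} :
    rightFactor f T S w = x ↔ w * (f x)⁻¹ ∈ leftReps S (f '' T) := by
  obtain ⟨z, hz, hw⟩ := h.exists_mul_rightFactor w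
  constructor
  · rintro rfl
    rwa [mul_inv_eq_of_eq_mul hw]
  · intro hx
    rw [← h.rightFactor_mul hx x, inv_mul_cancel_right]

theorem mem_descents_mul_iff {z : W} (hz : z ∈ leftReps S (f '' T)) (x : V) {t : V} (ht : t ∈ T) :
    f t ∈ descents S (z * f x) ↔ t ∈ descents T x := by
  simp only [descents, Set.mem_ofPred_eq, h.map_gen t ht, ht, true_and]
  rw [mul_assoc, ← map_mul, h.length_mul hz, h.length_mul hz]
  omega

theorem descents_rightFactor (w : W) :
    descents T (rightFactor f T S w) = {t | t ∈ T ∧ f t ∈ descents S w} := by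
  obtain ⟨z, hz, hw⟩ := h.exists_mul_rightFactor w
  ext t
  constructor
  · intro ht
    rw [hw]
    exact ⟨ht.1, (h.mem_descents_mul_iff hz _ ht.1).2 ht⟩
  · rintro ⟨ht, hd⟩
    rw [hw] at hd
    exact (h.mem_descents_mul_iff hz _ ht).1 hd

/-- Deodhar's lemma. -/
theorem mul_mem_rightReps_or {y : W} (hy : y ∈ rightReps S (f '' T)) {s : W} (hs : s ∈ S) :
    y * s ∈ rightReps S (f '' T) ∨ ∃ t ∈ T, y * s = f t * y := by
  rw [or_iff_not_imp_left, h.mem_rightReps_iff]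
  intro hys
  push Not at hys
  obtain ⟨t, ht, hle⟩ := hys
  have hft := h.map_gen t ht
  refine ⟨t, ht, ?_⟩
  have hne : length S (f t * (y * s)) ≠ length S (y * s) := by
    rw [h.involutiveGen.length_mul_left_eq _ hft, ← h.involutiveGen.length_inv (y * s)]
    exact h.isCoxeterSystem.length_mul_ne _ hft
  have hty := h.mem_rightReps_iff.1 hy t ht
  have hys := h.involutiveGen.length_mul_le_add_one y hs
  have htys := h.involutiveGen.length_le_mul_add_one (f t * y) hs
  rw [← mul_assoc] at hle hne
  obtain ⟨a, ha, rfl, hlen⟩ := h.involutiveGen.exists_reduced y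
  rcases h.isCoxeterSystem.exchange_mul (f t) ha hs (by omega) with ⟨v, hv, heq⟩ | ⟨k, hk, heq⟩
  · have hone := h.involutiveGen.eq_one_of_length_eq_zero
      (Nat.lt_one_iff.1 (hv.trans_le (length_le_one hft)))
    rw [hone, one_mul, mul_assoc] at heq
    rw [← h.involutiveGen.inv_eq hft, eq_inv_mul_iff_mul_eq, heq]
  · have hlt := length_prod_eraseIdx_lt ha hk
    rw [← heq] at hlt
    omega

theorem mem_descents_mul_iff_of_mul_mem {y : W} (hy : y ∈ rightReps S (f '' T)) {s : W}
    (hys : y * s ∈ rightReps S (f '' T)) (x : V) :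
    s ∈ descents S (f x * y) ↔ s ∈ descents S y := by
  simp only [descents, Set.mem_ofPred_eq]
  rw [mul_assoc, h.length_mul_rightReps hys, h.length_mul_rightReps hy, add_lt_add_iff_left]

theorem mem_descents_mul_iff_of_mul_eq {y : W} (hy : y ∈ rightReps S (f '' T)) {s : W}
    (hs : s ∈ S) {t : V} (ht : t ∈ T) (heq : y * s = f t * y) (x : V) :
    s ∈ descents S (f x * y) ↔ t ∈ descents T x := by
  simp only [descents, Set.mem_ofPred_eq, hs, ht, true_and]
  rw [mul_assoc, heq, ← mul_assoc, ← map_mul, h.length_mul_rightReps hy,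
    h.length_mul_rightReps hy, add_lt_add_iff_right]

theorem descents_mul_congr {y : W} (hy : y ∈ rightReps S (f '' T)) {x x' : V}
    (hx : descents T x = descents T x') : descents S (f x * y) = descents S (f x' * y) := by
  ext s
  by_cases hs : s ∈ S
  · rcases h.mul_mem_rightReps_or hy hs with hys | ⟨t, ht, heq⟩
    · rw [h.mem_descents_mul_iff_of_mul_mem hy hys, h.mem_descents_mul_iff_of_mul_mem hy hys]
    · rw [h.mem_descents_mul_iff_of_mul_eq hy hs ht heq,
        h.mem_descents_mul_iff_of_mul_eq hy hs ht heq, hx]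
  · exact iff_of_false (fun hd => hs hd.1) fun hd => hs hd.1

section Comp

variable {U : Type u} [Group U] {g : U →* V} {R : Set U} (hg : IsParabolicEmbedding g R T)
include hg

theorem comp : IsParabolicEmbedding (f.comp g) R S :=
  ⟨h.injective.comp hg.injective, fun r hr => h.map_gen _ (hg.map_gen r hr), hg.closure_eq,
    h.isCoxeterSystem⟩

theorem rightFactor_comp (w : W) :
    rightFactor (f.comp g) R S w = rightFactor g R T (rightFactor f T S w) := by
  obtain ⟨z, hz, hw⟩ := h.exists_mul_rightFactor w
  rw [(h.comp hg).rightFactor_eq_iff, (h.comp hg).mem_leftReps_iff]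
  obtain ⟨y, hy, hv⟩ := hg.exists_mul_rightFactor (rightFactor f T S w)
  set v := rightFactor f T S w
  have hzy : w * (f.comp g (rightFactor g R T v))⁻¹ = z * f y := by
    rw [mul_inv_eq_iff_eq_mul, MonoidHom.comp_apply, mul_assoc, ← map_mul, ← hv, hw]
  intro r hr
  rw [hzy, MonoidHom.comp_apply, mul_assoc, ← map_mul, h.length_mul hz, h.length_mul hz]
  exact Nat.add_lt_add_left (hg.mem_leftReps_iff.1 hy r hr) _

end Comp

end IsParabolicEmbedding

namespace IsCoxeterSystem

variable {S : Set W} (hS : IsCoxeterSystem S)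
include hS

theorem isParabolicEmbedding_id : IsParabolicEmbedding (MonoidHom.id W) S S :=
  ⟨Function.injective_id, fun _ h => h, hS.involutiveGen.closure_eq, hS⟩

theorem rightFactor_id (w : W) : rightFactor (MonoidHom.id W) S S w = w := by
  rw [hS.isParabolicEmbedding_id.rightFactor_eq_iff, MonoidHom.id_apply, mul_inv_cancel]
  rintro s ⟨-, hlt⟩
  rw [length_one] at hlt
  exact absurd hlt (Nat.not_lt_zero _)

theorem isParabolicEmbedding_subtype {I : Set W} (hI : I ⊆ S) :
    IsParabolicEmbedding (Subgroup.closure I).subtype (parabolicGens I) S :=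
  ⟨Subtype.val_injective, fun _ ht => hI ht, Subgroup.closure_closure_coe_preimage, hS⟩

end IsCoxeterSystem

theorem Cox.Hom.isParabolicEmbedding {X Y : Cox.{u}} (e : X ⟶ Y) :
    IsParabolicEmbedding (Cox.Hom.hom e) X.S Y.S :=
  ⟨e.injective, e.map_gen, X.isCoxeterSystem.involutiveGen.closure_eq, Y.isCoxeterSystem⟩

end Parabolic

/-! ### The group algebra -/

section GroupAlgebra

theorem linearMap_ext_of {k G N : Type*} [Semiring k] [Monoid G] [AddCommMonoid N] [Module k N]
    {φ ψ : MonoidAlgebra k G →ₗ[k] N}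
    (h : ∀ g, φ (MonoidAlgebra.of k G g) = ψ (MonoidAlgebra.of k G g)) : φ = ψ :=
  MonoidAlgebra.lhom_ext' fun g => LinearMap.ext_ring (h g)

variable {W : Type u} [Group W]

theorem groupForm_of_of (v w : W) [Decidable (v = w)] :
    groupForm W (MonoidAlgebra.of ℤ W v) (MonoidAlgebra.of ℤ W w) = if v = w then 1 else 0 := by
  rw [groupForm, linearExtend_of, linearExtend_of]
  congr

theorem groupForm_comm (x y : MonoidAlgebra ℤ W) : groupForm W x y = groupForm W y x := by
  classical
  suffices h : groupForm W = (groupForm W).flip from LinearMap.congr_fun₂ h x y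
  refine linearMap_ext_of fun v => linearMap_ext_of fun w => ?_
  rw [LinearMap.flip_apply, groupForm_of_of, groupForm_of_of]
  exact if_congr eq_comm rfl rfl

theorem groupForm_of_left (w : W) (x : MonoidAlgebra ℤ W) :
    groupForm W (MonoidAlgebra.of ℤ W w) x = x.coeff w := by
  classical
  suffices h : groupForm W (MonoidAlgebra.of ℤ W w) = (MonoidAlgebra.basis W ℤ).coord w from
    LinearMap.congr_fun h x
  refine (MonoidAlgebra.basis W ℤ).ext fun v => ?_
  rw [Module.Basis.coord_apply, Module.Basis.repr_self, Finsupp.single_apply]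
  exact (groupForm_of_of w v).trans (if_congr eq_comm rfl rfl)

theorem invMap_of (w : W) : invMap W (MonoidAlgebra.of ℤ W w) = MonoidAlgebra.of ℤ W w⁻¹ :=
  linearExtend_of _ _

theorem invMap_invMap (x : MonoidAlgebra ℤ W) : invMap W (invMap W x) = x := by
  suffices h : invMap W ∘ₗ invMap W = LinearMap.id from LinearMap.congr_fun h x
  refine linearMap_ext_of fun w => ?_
  rw [LinearMap.comp_apply, invMap_of, invMap_of, inv_inv, LinearMap.id_apply]

theorem invMap_surjective : Function.Surjective (invMap W) :=
  Function.Involutive.surjective invMap_invMap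

theorem groupForm_invMap (x y : MonoidAlgebra ℤ W) :
    groupForm W (invMap W x) y = groupForm W x (invMap W y) := by
  classical
  suffices h : groupForm W ∘ₗ invMap W = (groupForm W).compl₂ (invMap W) from
    LinearMap.congr_fun₂ h x y
  refine linearMap_ext_of fun v => linearMap_ext_of fun w => ?_
  rw [LinearMap.comp_apply, LinearMap.compl₂_apply, invMap_of, invMap_of, groupForm_of_of,
    groupForm_of_of]
  exact if_congr inv_eq_iff_eq_inv rfl rfl

theorem coeff_invMap (x : MonoidAlgebra ℤ W) (w : W) : (invMap W x).coeff w = x.coeff w⁻¹ := by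
  rw [← groupForm_of_left, ← groupForm_invMap, invMap_of, groupForm_of_left]

variable [Finite W]

theorem coeff_setSum (A : Set W) (w : W) [Decidable (w ∈ A)] :
    (setSum A).coeff w = if w ∈ A then 1 else 0 := by
  classical
  rw [← groupForm_of_left, setSum, map_sum]
  simp only [groupForm_of_of, Finset.sum_ite_eq, Set.Finite.mem_toFinset]

theorem groupForm_setSum_left (A : Set W) (x : MonoidAlgebra ℤ W) :
    groupForm W (setSum A) x = ∑ w ∈ A.toFinite.toFinset, x.coeff w := by
  simp only [setSum, map_sum, LinearMap.sum_apply, groupForm_of_left]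

end GroupAlgebra

/-! ### The descent algebra and its dual -/

section DescentAlgebra

variable {W : Type u} [Group W] {S : Set W}

theorem subset_of_mem_range_descents {I : Set W} (hI : I ∈ Set.range (descents S)) : I ⊆ S := by
  obtain ⟨w, rfl⟩ := hI
  exact fun _ hs => hs.1

variable [Finite W]

theorem coeff_sum_smul_descentClass [Fintype (Set.range (descents S))]
    (c : Set.range (descents S) → ℤ) (w : W) :
    (∑ I, c I • setSum (descentClass S (I : Set W))).coeff w = c (Set.rangeFactorization _ w) := by
  classical
  have hw : w ∈ descentClass S (Set.rangeFactorization (descents S) w : Set W) := rfl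
  rw [MonoidAlgebra.coeff_sum, Finsupp.finsetSum_apply,
    Fintype.sum_eq_single (Set.rangeFactorization (descents S) w)]
  · rw [MonoidAlgebra.coeff_smul, Finsupp.smul_apply, coeff_setSum, if_pos hw, smul_eq_mul,
      mul_one]
  · intro I hI
    rw [MonoidAlgebra.coeff_smul, Finsupp.smul_apply, coeff_setSum,
      if_neg fun hwI => hI (Subtype.ext hwI.symm), smul_zero]

theorem sum_smul_descentClass_mem [Fintype (Set.range (descents S))]
    (c : Set.range (descents S) → ℤ) :
    ∑ I, c I • setSum (descentClass S (I : Set W)) ∈ descentAlg S :=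
  Submodule.sum_mem _ fun I _ => Submodule.smul_mem _ _
    (descentElt S I (subset_of_mem_range_descents I.2)).2

theorem mem_descentAlg_iff {x : MonoidAlgebra ℤ W} :
    x ∈ descentAlg S ↔ ∀ v w, descents S v = descents S w → x.coeff v = x.coeff w := by
  classical
  constructor
  · intro hx v w hvw
    induction hx using Submodule.span_induction with
    | mem y hy =>
      obtain ⟨I, -, rfl⟩ := hy
      rw [coeff_setSum, coeff_setSum]
      exact if_congr (by rw [descentClass, Set.mem_ofPred_eq, Set.mem_ofPred_eq, hvw]) rfl rfl
    | zero => rfl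
    | add y z _ _ hy hz =>
      rw [MonoidAlgebra.coeff_add, Finsupp.add_apply, Finsupp.add_apply, hy, hz]
    | smul a y _ hy =>
      rw [MonoidAlgebra.coeff_smul, Finsupp.smul_apply, Finsupp.smul_apply, hy]
  · intro hx
    have := Fintype.ofFinite (Set.range (descents S))
    convert sum_smul_descentClass_mem fun I => x.coeff (Set.rangeSplitting (descents S) I)
    refine MonoidAlgebra.coeff_injective (Finsupp.ext fun w => ?_)
    rw [coeff_sum_smul_descentClass]
    exact hx _ _ (Set.apply_rangeSplitting (descents S)
      (Set.rangeFactorization (descents S) w)).symm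

theorem chi_apply (u : MonoidAlgebra ℤ W) (x : descentAlg S) : chi S u x = groupForm W u x := rfl

theorem coe_descentElt {I : Set W} (hI : I ⊆ S) :
    (descentElt S I hI : MonoidAlgebra ℤ W) = setSum (descentClass S I) := rfl

/-- The coefficients of an element of `Σ(W)` on the nonempty descent classes. Their indices are
the descent sets that occur. -/
def descentCoeffs (S : Set W) : descentAlg S →ₗ[ℤ] Set.range (descents S) → ℤ :=
  LinearMap.pi fun I => chi S (MonoidAlgebra.of ℤ W (Set.rangeSplitting (descents S) I))

theorem descentCoeffs_apply (x : descentAlg S) (I : Set.range (descents S)) :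
    descentCoeffs S x I = (x : MonoidAlgebra ℤ W).coeff (Set.rangeSplitting (descents S) I) :=
  groupForm_of_left _ _

theorem descentCoeffs_bijective : Function.Bijective (descentCoeffs S) := by
  constructor
  · intro x y hxy
    refine Subtype.ext (MonoidAlgebra.coeff_injective (Finsupp.ext fun w => ?_))
    have hw := congrFun hxy (Set.rangeFactorization (descents S) w)
    have hdesc := Set.apply_rangeSplitting (descents S) (Set.rangeFactorization (descents S) w)
    rw [descentCoeffs_apply, descentCoeffs_apply] at hw
    rwa [mem_descentAlg_iff.1 x.2 _ w hdesc, mem_descentAlg_iff.1 y.2 _ w hdesc] at hw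
  · intro c
    have := Fintype.ofFinite (Set.range (descents S))
    refine ⟨⟨_, sum_smul_descentClass_mem c⟩, funext fun I => ?_⟩
    rw [descentCoeffs_apply, coeff_sum_smul_descentClass]
    exact congrArg c (Subtype.ext (Set.apply_rangeSplitting (descents S) I))

/-- The basis of `Σ(W)` formed by the sums of the nonempty descent classes. -/
def descentBasis (S : Set W) : Module.Basis (Set.range (descents S)) ℤ (descentAlg S) :=
  .ofEquivFun (.ofBijective (descentCoeffs S) descentCoeffs_bijective)

theorem descentBasis_coord (I : Set.range (descents S)) :
    (descentBasis S).coord I =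
      chi S (MonoidAlgebra.of ℤ W (Set.rangeSplitting (descents S) I)) := rfl

theorem descentBasis_apply (I : Set.range (descents S)) :
    descentBasis S I = descentElt S I (subset_of_mem_range_descents I.2) := by
  classical
  refine (descentBasis S).ext_elem fun J => ?_
  rw [Module.Basis.repr_self, ← Module.Basis.coord_apply, descentBasis_coord, chi_of_descentElt,
    Set.apply_rangeSplitting (descents S) J, Finsupp.single_apply]
  exact if_congr (eq_comm.trans Subtype.ext_iff) rfl rfl

/-- `χ` sends one representative of each nonempty descent class to the dual basis. -/
theorem chi_surjective : Function.Surjective (chi S) := by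
  intro φ
  have := Fintype.ofFinite (Set.range (descents S))
  refine ⟨∑ I, φ (descentBasis S I) •
    MonoidAlgebra.of ℤ W (Set.rangeSplitting (descents S) I), ?_⟩
  simp only [map_sum, map_smul, ← descentBasis_coord]
  exact (descentBasis S).sum_dual_apply_smul_coord φ

theorem chiInv_apply (u : MonoidAlgebra ℤ W) (x : descentAlg S) :
    chiInv S u x = groupForm W (invMap W u) x := rfl

theorem coe_chiLam (x : descentAlg S) : (chiLam S x : DescentDual S) = chiInv S x := rfl

theorem chiInv_surjective : Function.Surjective (chiInv S) :=
  chi_surjective.comp invMap_surjective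

theorem chiLam_surjective : Function.Surjective (chiLam S) := by
  rintro ⟨_, x, hx, rfl⟩
  exact ⟨⟨x, hx⟩, rfl⟩

end DescentAlgebra

/-! ### The form on `Λ` -/

section LamForm

variable {W : Type u} [Group W] [Finite W] {S : Set W}

theorem chiLam_apply_comm (x y : descentAlg S) :
    (chiLam S x : DescentDual S) y = (chiLam S y : DescentDual S) x := by
  rw [coe_chiLam, coe_chiLam, chiInv_apply, chiInv_apply, groupForm_invMap, groupForm_comm]

theorem ker_chiLam_le (S : Set W) :
    LinearMap.ker (chiLam S) ≤ LinearMap.ker (lam S).subtype.flip := by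
  intro x hx
  refine LinearMap.mem_ker.2 (LinearMap.ext fun y => ?_)
  obtain ⟨z, rfl⟩ := chiLam_surjective y
  change (chiLam S z : DescentDual S) x = 0
  rw [chiLam_apply_comm, LinearMap.mem_ker.1 hx]
  rfl

/-- The bilinear form on `Λ(W)` given by `⟨χ'(x), y⟩ = y(x)`. -/
def lamForm (S : Set W) : LinearMap.BilinForm ℤ (lam S) :=
  (LinearMap.ker (chiLam S)).liftQ (lam S).subtype.flip (ker_chiLam_le S) ∘ₗ
    (LinearMap.quotKerEquivOfSurjective (chiLam S) chiLam_surjective).symm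

theorem lamForm_chiLam (x : descentAlg S) (y : lam S) :
    lamForm S (chiLam S x) y = (y : DescentDual S) x := by
  have hx : LinearMap.quotKerEquivOfSurjective (chiLam S) chiLam_surjective
      ((LinearMap.ker (chiLam S)).mkQ x) = chiLam S x := rfl
  rw [lamForm, LinearMap.comp_apply, LinearEquiv.coe_coe, ← hx, LinearEquiv.symm_apply_apply]
  rfl

theorem isLamForm_lamForm (S : Set W) : IsLamForm S (lamForm S) := by
  classical
  intro I J hI hJ
  rw [lamElt, lamElt, lamForm_chiLam, coe_chiLam, chiInv_apply, groupForm_invMap, coe_descentElt,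
    coe_descentElt, groupForm_setSum_left]
  simp only [coeff_invMap, coeff_setSum]
  rw [Finset.sum_boole, descentCount, Set.ncard_eq_toFinset_card _ (Set.toFinite _)]
  congr 2
  ext w
  rw [Finset.mem_filter, Set.Finite.mem_toFinset, Set.Finite.mem_toFinset]
  exact and_comm

theorem IsLamForm.eq_lamForm {B : LinearMap.BilinForm ℤ (lam S)} (hB : IsLamForm S B) :
    B = lamForm S := by
  have h : B.compl₁₂ (chiLam S) (chiLam S) = (lamForm S).compl₁₂ (chiLam S) (chiLam S) := by
    refine (descentBasis S).ext fun I => (descentBasis S).ext fun J => ?_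
    rw [descentBasis_apply, descentBasis_apply]
    exact (hB _ _ _ _).trans (isLamForm_lamForm S _ _ _ _).symm
  refine LinearMap.ext₂ fun a b => ?_
  obtain ⟨x, rfl⟩ := chiLam_surjective a
  obtain ⟨y, rfl⟩ := chiLam_surjective b
  exact LinearMap.congr_fun₂ h x y

theorem lamForm_comm (a b : lam S) : lamForm S a b = lamForm S b a := by
  obtain ⟨x, rfl⟩ := chiLam_surjective a
  obtain ⟨y, rfl⟩ := chiLam_surjective b
  rw [lamForm_chiLam, lamForm_chiLam, chiLam_apply_comm]

theorem lamForm_isSymm (S : Set W) : (lamForm S).IsSymm := ⟨lamForm_comm⟩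

theorem lamForm_nondegenerate (S : Set W) : (lamForm S).Nondegenerate := by
  have hright : ∀ b : lam S, (∀ a, lamForm S a b = 0) → b = 0 := fun b hb =>
    Subtype.ext (LinearMap.ext fun x => (lamForm_chiLam x b).symm.trans (hb _))
  exact ⟨fun a ha => hright a fun b => (lamForm_comm b a).trans (ha b), hright⟩

theorem existsUnique_isLamForm (S : Set W) :
    ∃! B : LinearMap.BilinForm ℤ (lam S), IsLamForm S B :=
  ⟨lamForm S, isLamForm_lamForm S, fun _ hB => hB.eq_lamForm⟩

theorem IsLamForm.isSymm {B : LinearMap.BilinForm ℤ (lam S)} (hB : IsLamForm S B) : B.IsSymm :=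
  hB.eq_lamForm ▸ lamForm_isSymm S

theorem IsLamForm.nondegenerate {B : LinearMap.BilinForm ℤ (lam S)} (hB : IsLamForm S B) :
    B.Nondegenerate :=
  hB.eq_lamForm ▸ lamForm_nondegenerate S

end LamForm

/-! ### Induced maps -/

section Induced

variable {A B M N : Type*} [AddCommGroup A] [AddCommGroup B] [AddCommGroup M] [AddCommGroup N]
  [Module ℤ A] [Module ℤ B] [Module ℤ M] [Module ℤ N]

theorem comp_restrictAlong {i : A →ₗ[ℤ] M} {j : B →ₗ[ℤ] N} {g : M →ₗ[ℤ] N}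
    (h : ∃ g' : A →ₗ[ℤ] B, j ∘ₗ g' = g ∘ₗ i) : j ∘ₗ restrictAlong i j g = g ∘ₗ i := by
  rw [restrictAlong, dif_pos h]
  exact h.choose_spec

theorem descendAlong_eq {p : M →ₗ[ℤ] A} {q : N →ₗ[ℤ] B} {g : M →ₗ[ℤ] N} {g' : A →ₗ[ℤ] B}
    (hp : Function.Surjective p) (h : g' ∘ₗ p = q ∘ₗ g) : descendAlong p q g = g' := by
  have hex : ∃ g' : A →ₗ[ℤ] B, g' ∘ₗ p = q ∘ₗ g := ⟨g', h⟩
  rw [descendAlong, dif_pos hex]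
  exact LinearMap.ext fun a => by
    obtain ⟨m, rfl⟩ := hp a
    exact LinearMap.congr_fun (hex.choose_spec.trans h.symm) m

end Induced

/-! ### The maps of a parabolic embedding -/

section ParabolicMaps

variable {V W : Type u} [Group V] [Group W] {f : V →* W} {T : Set V} {S : Set W}

theorem mu_of [Finite W] (x : V) : mu f T S (MonoidAlgebra.of ℤ V x) =
    setSum (leftReps S (f '' T)) * MonoidAlgebra.of ℤ W (f x) :=
  linearExtend_of _ _

theorem muBar_of [Finite W] (x : V) : muBar f T S (MonoidAlgebra.of ℤ V x) =
    MonoidAlgebra.of ℤ W (f x) * setSum (rightReps S (f '' T)) :=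
  linearExtend_of _ _

theorem rho_of (w : W) :
    rho f T S (MonoidAlgebra.of ℤ W w) = MonoidAlgebra.of ℤ V (leftFactor f T S w) :=
  linearExtend_of _ _

theorem rhoBar_of (w : W) :
    rhoBar f T S (MonoidAlgebra.of ℤ W w) = MonoidAlgebra.of ℤ V (rightFactor f T S w) :=
  linearExtend_of _ _

theorem invMap_mu [Finite W] (x : MonoidAlgebra ℤ V) :
    invMap W (mu f T S x) = muBar f T S (invMap V x) := by
  classical
  suffices hs : invMap W ∘ₗ mu f T S = muBar f T S ∘ₗ invMap V from LinearMap.congr_fun hs x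
  refine linearMap_ext_of fun v => MonoidAlgebra.coeff_injective (Finsupp.ext fun w => ?_)
  rw [LinearMap.comp_apply, LinearMap.comp_apply, invMap_of, mu_of, muBar_of, coeff_invMap,
    MonoidAlgebra.of_apply, MonoidAlgebra.of_apply, MonoidAlgebra.coeff_mul_single_apply,
    MonoidAlgebra.coeff_single_mul_apply, coeff_setSum, coeff_setSum, mul_one, one_mul]
  refine if_congr ?_ rfl rfl
  rw [mem_rightReps_iff_inv_mem, mul_inv_rev, inv_inv, map_inv]

namespace IsParabolicEmbedding

variable (h : IsParabolicEmbedding f T S)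
include h

theorem invMap_rho (u : MonoidAlgebra ℤ W) :
    invMap V (rho f T S u) = rhoBar f T S (invMap W u) := by
  suffices hs : invMap V ∘ₗ rho f T S = rhoBar f T S ∘ₗ invMap W from LinearMap.congr_fun hs u
  refine linearMap_ext_of fun w => ?_
  rw [LinearMap.comp_apply, LinearMap.comp_apply, invMap_of, rho_of, rhoBar_of, invMap_of,
    h.leftFactor_eq_inv, inv_inv]

variable [Finite W]

theorem groupForm_mu (u : MonoidAlgebra ℤ W) (x : MonoidAlgebra ℤ V) :
    groupForm W u (mu f T S x) = groupForm V (rhoBar f T S u) x := by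
  classical
  suffices hs : (groupForm W).compl₂ (mu f T S) = groupForm V ∘ₗ rhoBar f T S from
    LinearMap.congr_fun₂ hs u x
  refine linearMap_ext_of fun w => linearMap_ext_of fun v => ?_
  rw [LinearMap.compl₂_apply, LinearMap.comp_apply, mu_of, rhoBar_of, groupForm_of_left,
    groupForm_of_of, MonoidAlgebra.of_apply, MonoidAlgebra.coeff_mul_single_apply, coeff_setSum,
    mul_one]
  exact if_congr h.rightFactor_eq_iff.symm rfl rfl

theorem coeff_mu (x : MonoidAlgebra ℤ V) (w : W) :
    (mu f T S x).coeff w = x.coeff (rightFactor f T S w) := by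
  rw [← groupForm_of_left, h.groupForm_mu, rhoBar_of, groupForm_of_left]

theorem groupForm_muBar (x : MonoidAlgebra ℤ V) (u : MonoidAlgebra ℤ W) :
    groupForm W (muBar f T S x) u = groupForm V x (rho f T S u) :=
  calc groupForm W (muBar f T S x) u
      = groupForm W (mu f T S (invMap V x)) (invMap W u) := by
        rw [← groupForm_invMap, invMap_mu, invMap_invMap]
    _ = groupForm V (invMap V x) (invMap V (rho f T S u)) := by
        rw [groupForm_comm, h.groupForm_mu, groupForm_comm, h.invMap_rho]
    _ = groupForm V x (rho f T S u) := by
        rw [groupForm_invMap, invMap_invMap]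

theorem coeff_rho (u : MonoidAlgebra ℤ W) (v : V) :
    (rho f T S u).coeff v =
      ∑ y ∈ (Set.toFinite (rightReps S (f '' T))).toFinset, u.coeff (f v * y) := by
  rw [← groupForm_of_left, ← h.groupForm_muBar, muBar_of, setSum, Finset.mul_sum]
  simp only [← map_mul, map_sum, LinearMap.sum_apply, groupForm_of_left]

variable [Finite V]

theorem mu_mem {x : MonoidAlgebra ℤ V} (hx : x ∈ descentAlg T) :
    mu f T S x ∈ descentAlg S := by
  rw [mem_descentAlg_iff] at hx ⊢
  intro v w hvw
  rw [h.coeff_mu, h.coeff_mu]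
  exact hx _ _ (by rw [h.descents_rightFactor, h.descents_rightFactor, hvw])

theorem rho_mem {u : MonoidAlgebra ℤ W} (hu : u ∈ descentAlg S) :
    rho f T S u ∈ descentAlg T := by
  rw [mem_descentAlg_iff] at hu ⊢
  intro v w hvw
  rw [h.coeff_rho, h.coeff_rho]
  exact Finset.sum_congr rfl fun y hy =>
    hu _ _ (h.descents_mul_congr ((Set.Finite.mem_toFinset _).1 hy) hvw)

theorem subtype_comp_muSigma :
    (descentAlg S).subtype ∘ₗ muSigma f T S = mu f T S ∘ₗ (descentAlg T).subtype :=
  comp_restrictAlong ⟨(mu f T S).restrict fun _ => h.mu_mem, rfl⟩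

theorem subtype_comp_rhoSigma :
    (descentAlg T).subtype ∘ₗ rhoSigma f T S = rho f T S ∘ₗ (descentAlg S).subtype :=
  comp_restrictAlong ⟨(rho f T S).restrict fun _ => h.rho_mem, rfl⟩

theorem coe_muSigma (x : descentAlg T) :
    (muSigma f T S x : MonoidAlgebra ℤ W) = mu f T S x :=
  LinearMap.congr_fun h.subtype_comp_muSigma x

theorem coe_rhoSigma (x : descentAlg S) :
    (rhoSigma f T S x : MonoidAlgebra ℤ V) = rho f T S x :=
  LinearMap.congr_fun h.subtype_comp_rhoSigma x

theorem dualMap_muSigma_comp_chi :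
    (muSigma f T S).dualMap ∘ₗ chi S = chi T ∘ₗ rhoBar f T S := by
  refine LinearMap.ext fun u => LinearMap.ext fun x => ?_
  rw [LinearMap.comp_apply, LinearMap.dualMap_apply, chi_apply, h.coe_muSigma, h.groupForm_mu]
  rfl

theorem dualMap_rhoSigma_comp_chi :
    (rhoSigma f T S).dualMap ∘ₗ chi T = chi S ∘ₗ muBar f T S := by
  refine LinearMap.ext fun u => LinearMap.ext fun x => ?_
  rw [LinearMap.comp_apply, LinearMap.dualMap_apply, chi_apply, h.coe_rhoSigma,
    ← h.groupForm_muBar]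
  rfl

theorem rhoBarDual_eq : rhoBarDual f T S = (muSigma f T S).dualMap :=
  descendAlong_eq chi_surjective h.dualMap_muSigma_comp_chi

theorem muBarDual_eq : muBarDual f T S = (rhoSigma f T S).dualMap :=
  descendAlong_eq chi_surjective h.dualMap_rhoSigma_comp_chi

theorem rhoBarDual_comp_chi : rhoBarDual f T S ∘ₗ chi S = chi T ∘ₗ rhoBar f T S := by
  rw [h.rhoBarDual_eq, h.dualMap_muSigma_comp_chi]

theorem muBarDual_comp_chi : muBarDual f T S ∘ₗ chi T = chi S ∘ₗ muBar f T S := by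
  rw [h.muBarDual_eq, h.dualMap_rhoSigma_comp_chi]

theorem chiInv_comp_mu : chiInv S ∘ₗ mu f T S = muBarDual f T S ∘ₗ chiInv T := by
  refine LinearMap.ext fun x => ?_
  rw [chiInv, chiInv, LinearMap.comp_apply, LinearMap.comp_apply, invMap_mu,
    ← LinearMap.comp_assoc, h.muBarDual_comp_chi]
  rfl

theorem chiInv_comp_rho : chiInv T ∘ₗ rho f T S = rhoBarDual f T S ∘ₗ chiInv S := by
  refine LinearMap.ext fun u => ?_
  rw [chiInv, chiInv, LinearMap.comp_apply, LinearMap.comp_apply, h.invMap_rho,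
    ← LinearMap.comp_assoc, h.rhoBarDual_comp_chi]
  rfl

theorem muBarDual_chiInv (x : MonoidAlgebra ℤ V) :
    muBarDual f T S (chiInv T x) = chiInv S (mu f T S x) :=
  (LinearMap.congr_fun h.chiInv_comp_mu x).symm

theorem rhoBarDual_chiInv (u : MonoidAlgebra ℤ W) :
    rhoBarDual f T S (chiInv S u) = chiInv T (rho f T S u) :=
  (LinearMap.congr_fun h.chiInv_comp_rho u).symm

theorem subtype_comp_muBarLam :
    (lam S).subtype ∘ₗ muBarLam f T S = muBarDual f T S ∘ₗ (lam T).subtype := by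
  refine comp_restrictAlong ⟨(muBarDual f T S).restrict ?_, rfl⟩
  rintro _ ⟨x, hx, rfl⟩
  rw [h.muBarDual_chiInv]
  exact Submodule.mem_map_of_mem (h.mu_mem hx)

theorem subtype_comp_rhoBarLam :
    (lam T).subtype ∘ₗ rhoBarLam f T S = rhoBarDual f T S ∘ₗ (lam S).subtype := by
  refine comp_restrictAlong ⟨(rhoBarDual f T S).restrict ?_, rfl⟩
  rintro _ ⟨x, hx, rfl⟩
  rw [h.rhoBarDual_chiInv]
  exact Submodule.mem_map_of_mem (h.rho_mem hx)

theorem coe_muBarLam (y : lam T) :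
    (muBarLam f T S y : DescentDual S) = muBarDual f T S y :=
  LinearMap.congr_fun h.subtype_comp_muBarLam y

theorem coe_rhoBarLam (y : lam S) :
    (rhoBarLam f T S y : DescentDual T) = rhoBarDual f T S y :=
  LinearMap.congr_fun h.subtype_comp_rhoBarLam y

theorem chiLam_comp_muSigma :
    chiLam S ∘ₗ muSigma f T S = muBarLam f T S ∘ₗ chiLam T := by
  refine LinearMap.ext fun x => Subtype.ext ?_
  rw [LinearMap.comp_apply, LinearMap.comp_apply, h.coe_muBarLam, coe_chiLam, coe_chiLam,
    h.coe_muSigma, h.muBarDual_chiInv]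

theorem chiLam_comp_rhoSigma :
    chiLam T ∘ₗ rhoSigma f T S = rhoBarLam f T S ∘ₗ chiLam S := by
  refine LinearMap.ext fun x => Subtype.ext ?_
  rw [LinearMap.comp_apply, LinearMap.comp_apply, h.coe_rhoBarLam, coe_chiLam, coe_chiLam,
    h.coe_rhoSigma, h.rhoBarDual_chiInv]

theorem lamForm_muBarLam (a : lam T) (b : lam S) :
    lamForm S (muBarLam f T S a) b = lamForm T a (rhoBarLam f T S b) := by
  obtain ⟨x, rfl⟩ := chiLam_surjective a
  have hx : muBarLam f T S (chiLam T x) = chiLam S (muSigma f T S x) :=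
    (LinearMap.congr_fun h.chiLam_comp_muSigma x).symm
  rw [hx, lamForm_chiLam, lamForm_chiLam, h.coe_rhoBarLam, h.rhoBarDual_eq, LinearMap.dualMap_apply]

theorem apply_muBarLam_of_isLamForm {C : LinearMap.BilinForm ℤ (lam T)}
    {B : LinearMap.BilinForm ℤ (lam S)} (hC : IsLamForm T C) (hB : IsLamForm S B)
    (a : lam T) (b : lam S) : B (muBarLam f T S a) b = C a (rhoBarLam f T S b) := by
  rw [hC.eq_lamForm, hB.eq_lamForm, h.lamForm_muBarLam]

end IsParabolicEmbedding

end ParabolicMaps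

/-! ### Functoriality -/

section Functoriality

namespace IsFunctorial

variable {C D : Type*} [Category C] [Category D] {P Q : C ⥤q D} {α : ∀ X, P.obj X ⟶ Q.obj X}
  (hα : ∀ {X Y : C} (f : X ⟶ Y), P.map f ≫ α Y = α X ≫ Q.map f)
include hα

theorem of_mono [∀ X, Mono (α X)] (hQ : IsFunctorial Q) : IsFunctorial P := by
  refine ⟨fun X => ?_, fun {X Y Z} f g => ?_⟩
  · rw [← cancel_mono (α X), hα, hQ.1, Category.comp_id, Category.id_comp]
  · rw [← cancel_mono (α Z), hα, hQ.2, ← Category.assoc, ← hα, Category.assoc, ← hα, Category.assoc]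

theorem of_epi [∀ X, Epi (α X)] (hP : IsFunctorial P) : IsFunctorial Q := by
  refine ⟨fun X => ?_, fun {X Y Z} f g => ?_⟩
  · rw [← cancel_epi (α X), ← hα, hP.1, Category.comp_id, Category.id_comp]
  · rw [← cancel_epi (α X), ← hα, hP.2, Category.assoc, hα, ← Category.assoc, hα, Category.assoc]

end IsFunctorial

/-- The assignments `Ω`, `Σ`, `Σ*` and `Λ` on objects and morphisms are functors, and the families
`ι`, `χ`, `χL` and `ιL` are natural transformations, alternately monic and epic, that form a
commutative diamond. -/
def IsFunctorialDiamond {C D : Type*} [Category C] [Category D] (PΩ PS PD PL : C ⥤q D)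
    (ι : ∀ X, PS.obj X ⟶ PΩ.obj X) (χ : ∀ X, PΩ.obj X ⟶ PD.obj X)
    (χL : ∀ X, PS.obj X ⟶ PL.obj X) (ιL : ∀ X, PL.obj X ⟶ PD.obj X) : Prop :=
  ∃ (hΩ : IsFunctorial PΩ) (hS : IsFunctorial PS) (hD : IsFunctorial PD) (hL : IsFunctorial PL)
    (nι : toFunctor _ hS ⟶ toFunctor _ hΩ) (nχ : toFunctor _ hΩ ⟶ toFunctor _ hD)
    (nχL : toFunctor _ hS ⟶ toFunctor _ hL) (nιL : toFunctor _ hL ⟶ toFunctor _ hD),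
    (∀ X, nι.app X = ι X) ∧ (∀ X, nχ.app X = χ X) ∧ (∀ X, nχL.app X = χL X) ∧
    (∀ X, nιL.app X = ιL X) ∧ Mono nι ∧ Epi nχ ∧ Epi nχL ∧ Mono nιL ∧ nι ≫ nχ = nχL ≫ nιL

/-- Functoriality passes from `Ω` to the subobject `Σ` and the quotient `Σ*`, and from `Σ*` to the
subobject `Λ`. -/
theorem IsFunctorial.isFunctorialDiamond {C D : Type*} [Category C] [Category D]
    {PΩ PS PD PL : C ⥤q D} (hΩ : IsFunctorial PΩ)
    {ι : ∀ X, PS.obj X ⟶ PΩ.obj X} {χ : ∀ X, PΩ.obj X ⟶ PD.obj X}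
    {χL : ∀ X, PS.obj X ⟶ PL.obj X} {ιL : ∀ X, PL.obj X ⟶ PD.obj X}
    (mι : ∀ X, Mono (ι X)) (eχ : ∀ X, Epi (χ X)) (eχL : ∀ X, Epi (χL X)) (mιL : ∀ X, Mono (ιL X))
    (hι : ∀ {X Y : C} (f : X ⟶ Y), PS.map f ≫ ι Y = ι X ≫ PΩ.map f)
    (hχ : ∀ {X Y : C} (f : X ⟶ Y), PΩ.map f ≫ χ Y = χ X ≫ PD.map f)
    (hχL : ∀ {X Y : C} (f : X ⟶ Y), PS.map f ≫ χL Y = χL X ≫ PL.map f)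
    (hιL : ∀ {X Y : C} (f : X ⟶ Y), PL.map f ≫ ιL Y = ιL X ≫ PD.map f)
    (hcomm : ∀ X, ι X ≫ χ X = χL X ≫ ιL X) :
    IsFunctorialDiamond PΩ PS PD PL ι χ χL ιL :=
  have hS := of_mono hι hΩ
  have hD := of_epi hχ hΩ
  have hL := of_mono hιL hD
  let nι : toFunctor _ hS ⟶ toFunctor _ hΩ := ⟨ι, fun _ _ f => hι f⟩
  let nχ : toFunctor _ hΩ ⟶ toFunctor _ hD := ⟨χ, fun _ _ f => hχ f⟩
  let nχL : toFunctor _ hS ⟶ toFunctor _ hL := ⟨χL, fun _ _ f => hχL f⟩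
  let nιL : toFunctor _ hL ⟶ toFunctor _ hD := ⟨ιL, fun _ _ f => hιL f⟩
  have : ∀ X, Mono (nι.app X) := mι
  have : ∀ X, Epi (nχ.app X) := eχ
  have : ∀ X, Epi (nχL.app X) := eχL
  have : ∀ X, Mono (nιL.app X) := mιL
  ⟨hΩ, hS, hD, hL, nι, nχ, nχL, nιL, fun _ => rfl, fun _ => rfl, fun _ => rfl, fun _ => rfl,
    NatTrans.mono_of_mono_app _, NatTrans.epi_of_epi_app _, NatTrans.epi_of_epi_app _,
    NatTrans.mono_of_mono_app _, NatTrans.ext (funext hcomm)⟩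

namespace IsCoxeterSystem

variable {W : Type u} [Group W] {S : Set W} (hS : IsCoxeterSystem S)
include hS

theorem mu_id [Finite W] : mu (MonoidHom.id W) S S = LinearMap.id :=
  LinearMap.ext fun x => MonoidAlgebra.coeff_injective <| Finsupp.ext fun w => by
    rw [hS.isParabolicEmbedding_id.coeff_mu, hS.rightFactor_id, LinearMap.id_apply]

theorem rho_id : rho (MonoidHom.id W) S S = LinearMap.id := by
  refine linearMap_ext_of fun w => ?_
  rw [rho_of, hS.isParabolicEmbedding_id.leftFactor_eq_inv, hS.rightFactor_id, inv_inv,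
    LinearMap.id_apply]

end IsCoxeterSystem

namespace IsParabolicEmbedding

variable {U V W : Type u} [Group U] [Group V] [Group W]
  {g : U →* V} {f : V →* W} {R : Set U} {T : Set V} {S : Set W}
  (h : IsParabolicEmbedding f T S) (hg : IsParabolicEmbedding g R T)
include h hg

theorem mu_comp [Finite W] [Finite V] : mu (f.comp g) R S = mu f T S ∘ₗ mu g R T :=
  LinearMap.ext fun x => MonoidAlgebra.coeff_injective <| Finsupp.ext fun w => by
    rw [LinearMap.comp_apply, (h.comp hg).coeff_mu, h.coeff_mu, hg.coeff_mu, h.rightFactor_comp hg]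

theorem rho_comp : rho (f.comp g) R S = rho g R T ∘ₗ rho f T S := by
  refine linearMap_ext_of fun w => ?_
  rw [LinearMap.comp_apply, rho_of, rho_of, rho_of, (h.comp hg).leftFactor_eq_inv,
    h.leftFactor_eq_inv, hg.leftFactor_eq_inv, inv_inv, h.rightFactor_comp hg]

end IsParabolicEmbedding

theorem isFunctorial_Omega : IsFunctorial Omega.{u} :=
  ⟨fun X => congrArg ModuleCat.ofHom X.isCoxeterSystem.mu_id, fun f g => congrArg ModuleCat.ofHom
    ((Cox.Hom.isParabolicEmbedding g).mu_comp (Cox.Hom.isParabolicEmbedding f))⟩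

theorem isFunctorial_OmegaOp : IsFunctorial OmegaOp.{u} :=
  ⟨fun X => congrArg ModuleCat.ofHom X.unop.isCoxeterSystem.rho_id, fun f g =>
    congrArg ModuleCat.ofHom ((Cox.Hom.isParabolicEmbedding f.unop).rho_comp
      (Cox.Hom.isParabolicEmbedding g.unop))⟩

section Components

variable {W : Type u} [Group W] [Finite W] (S : Set W)

theorem mono_subtype_descentAlg : Mono (ModuleCat.ofHom (descentAlg S).subtype) :=
  (ModuleCat.mono_iff_injective _).2 Subtype.val_injective

theorem epi_chiInv : Epi (ModuleCat.ofHom (chiInv S)) :=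
  (ModuleCat.epi_iff_surjective _).2 chiInv_surjective

theorem epi_chiLam : Epi (ModuleCat.ofHom (chiLam S)) :=
  (ModuleCat.epi_iff_surjective _).2 chiLam_surjective

theorem mono_subtype_lam : Mono (ModuleCat.ofHom (lam S).subtype) :=
  (ModuleCat.mono_iff_injective _).2 Subtype.val_injective

end Components

theorem isFunctorialDiamond_mu :
    IsFunctorialDiamond Omega.{u} Sigma SigmaDual Lambda
      (fun X => ModuleCat.ofHom (descentAlg X.S).subtype) (fun X => ModuleCat.ofHom (chiInv X.S))
      (fun X => ModuleCat.ofHom (chiLam X.S)) (fun X => ModuleCat.ofHom (lam X.S).subtype) :=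
  isFunctorial_Omega.isFunctorialDiamond
    (fun X => mono_subtype_descentAlg X.S) (fun X => epi_chiInv X.S)
    (fun X => epi_chiLam X.S) (fun X => mono_subtype_lam X.S)
    (fun f => congrArg ModuleCat.ofHom (Cox.Hom.isParabolicEmbedding f).subtype_comp_muSigma)
    (fun f => congrArg ModuleCat.ofHom (Cox.Hom.isParabolicEmbedding f).chiInv_comp_mu)
    (fun f => congrArg ModuleCat.ofHom (Cox.Hom.isParabolicEmbedding f).chiLam_comp_muSigma)
    (fun f => congrArg ModuleCat.ofHom (Cox.Hom.isParabolicEmbedding f).subtype_comp_muBarLam)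
    fun _ => rfl

theorem isFunctorialDiamond_rho :
    IsFunctorialDiamond OmegaOp.{u} SigmaOp SigmaDualOp LambdaOp
      (fun X => ModuleCat.ofHom (descentAlg X.unop.S).subtype)
      (fun X => ModuleCat.ofHom (chiInv X.unop.S)) (fun X => ModuleCat.ofHom (chiLam X.unop.S))
      (fun X => ModuleCat.ofHom (lam X.unop.S).subtype) :=
  isFunctorial_OmegaOp.isFunctorialDiamond
    (fun X => mono_subtype_descentAlg X.unop.S) (fun X => epi_chiInv X.unop.S)
    (fun X => epi_chiLam X.unop.S) (fun X => mono_subtype_lam X.unop.S)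
    (fun f => congrArg ModuleCat.ofHom (Cox.Hom.isParabolicEmbedding f.unop).subtype_comp_rhoSigma)
    (fun f => congrArg ModuleCat.ofHom (Cox.Hom.isParabolicEmbedding f.unop).chiInv_comp_rho)
    (fun f => congrArg ModuleCat.ofHom (Cox.Hom.isParabolicEmbedding f.unop).chiLam_comp_rhoSigma)
    (fun f => congrArg ModuleCat.ofHom (Cox.Hom.isParabolicEmbedding f.unop).subtype_comp_rhoBarLam)
    fun _ => rfl

end Functoriality

end CoxDescent

end

open CoxDescent in
theorem mainTheorem6_general :
    (∀ {W : Type u} [Group W] [Finite W] (S : Set W),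
      (∃! B : LinearMap.BilinForm ℤ (lam S), IsLamForm S B) ∧
      ∀ B : LinearMap.BilinForm ℤ (lam S), IsLamForm S B → B.IsSymm ∧ B.Nondegenerate) ∧
    (∀ {V W : Type u} [Group V] [Group W] [Finite V] [Finite W]
      {f : V →* W} {T : Set V} {S : Set W}, IsParabolicEmbedding f T S →
      ((descentAlg S).subtype ∘ₗ muSigma f T S = mu f T S ∘ₗ (descentAlg T).subtype ∧
        (descentAlg T).subtype ∘ₗ rhoSigma f T S = rho f T S ∘ₗ (descentAlg S).subtype ∧
        muBarDual f T S ∘ₗ chi T = chi S ∘ₗ muBar f T S ∧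
        rhoBarDual f T S ∘ₗ chi S = chi T ∘ₗ rhoBar f T S) ∧
      (Function.Surjective (chiLam S) ∧ Function.Surjective (chiLam T) ∧
        Function.Injective (lam S).subtype ∧ Function.Injective (lam T).subtype) ∧
      (chiLam S ∘ₗ muSigma f T S = muBarLam f T S ∘ₗ chiLam T ∧
        (lam S).subtype ∘ₗ muBarLam f T S = muBarDual f T S ∘ₗ (lam T).subtype ∧
        chiLam T ∘ₗ rhoSigma f T S = rhoBarLam f T S ∘ₗ chiLam S ∧
        (lam T).subtype ∘ₗ rhoBarLam f T S = rhoBarDual f T S ∘ₗ (lam S).subtype) ∧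
      ((∀ x φ, rhoBarDual f T S φ x = φ (muSigma f T S x)) ∧
        (∀ x φ, muBarDual f T S φ x = φ (rhoSigma f T S x)) ∧
        ∃ (C : LinearMap.BilinForm ℤ (lam T)) (B : LinearMap.BilinForm ℤ (lam S)),
          IsLamForm T C ∧ IsLamForm S B ∧
          (∀ x y, B (chiLam S x) y = (lam S).subtype y x) ∧
          (∀ x y, C (chiLam T x) y = (lam T).subtype y x) ∧
          (∀ x y, B (muBarLam f T S x) y = C x (rhoBarLam f T S y)))) ∧
    IsFunctorialDiamond Omega.{u} CoxDescent.Sigma SigmaDual Lambda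
      (fun X => ModuleCat.ofHom (descentAlg X.S).subtype) (fun X => ModuleCat.ofHom (chiInv X.S))
      (fun X => ModuleCat.ofHom (chiLam X.S)) (fun X => ModuleCat.ofHom (lam X.S).subtype) ∧
    IsFunctorialDiamond OmegaOp.{u} SigmaOp SigmaDualOp LambdaOp
      (fun X => ModuleCat.ofHom (descentAlg X.unop.S).subtype)
      (fun X => ModuleCat.ofHom (chiInv X.unop.S)) (fun X => ModuleCat.ofHom (chiLam X.unop.S))
      (fun X => ModuleCat.ofHom (lam X.unop.S).subtype) ∧
    (∀ {V W : Type u} [Group V] [Group W] [Finite V] [Finite W]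
      {f : V →* W} {T : Set V} {S : Set W}, IsParabolicEmbedding f T S →
      rhoBarDual f T S = (muSigma f T S).dualMap ∧ muBarDual f T S = (rhoSigma f T S).dualMap ∧
      ∀ (C : LinearMap.BilinForm ℤ (lam T)) (B : LinearMap.BilinForm ℤ (lam S)),
        IsLamForm T C → IsLamForm S B →
        ∀ x y, B (muBarLam f T S x) y = C x (rhoBarLam f T S y)) := by
  refine ⟨fun S => ⟨existsUnique_isLamForm S, fun B hB => ⟨hB.isSymm, hB.nondegenerate⟩⟩,
    fun {V W} _ _ _ _ {f T S} h => ⟨?restrictions, ?rows, ?squares, ?duality⟩,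
    isFunctorialDiamond_mu, isFunctorialDiamond_rho, fun h =>
      ⟨h.rhoBarDual_eq, h.muBarDual_eq, fun C B hC hB => h.apply_muBarLam_of_isLamForm hC hB⟩⟩
  case restrictions =>
    exact ⟨h.subtype_comp_muSigma, h.subtype_comp_rhoSigma, h.muBarDual_comp_chi,
      h.rhoBarDual_comp_chi⟩
  case rows =>
    exact ⟨chiLam_surjective, chiLam_surjective, Subtype.val_injective, Subtype.val_injective⟩
  case squares =>
    exact ⟨h.chiLam_comp_muSigma, h.subtype_comp_muBarLam, h.chiLam_comp_rhoSigma,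
      h.subtype_comp_rhoBarLam⟩
  case duality =>
    refine ⟨fun x φ => ?_, fun x φ => ?_, lamForm T, lamForm S, isLamForm_lamForm T,
      isLamForm_lamForm S, lamForm_chiLam, lamForm_chiLam, h.lamForm_muBarLam⟩
    · rw [h.rhoBarDual_eq, LinearMap.dualMap_apply]
    · rw [h.muBarDual_eq, LinearMap.dualMap_apply]

theorem mainTheorem6 :
    -- The form on `Λ(W)`.
    (∀ {W : Type u} [Group W] [Finite W] (S : Set W), CoxDescent.IsCoxeterSystem S →
      (∃! B : LinearMap.BilinForm ℤ (CoxDescent.lam S), CoxDescent.IsLamForm S B) ∧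
      ∀ B : LinearMap.BilinForm ℤ (CoxDescent.lam S), CoxDescent.IsLamForm S B →
        B.IsSymm ∧ B.Nondegenerate) ∧
    -- The diagram and its self-duality for a parabolic subgroup `W_I`, with inclusion `f`.
    (∀ {W : Type u} [Group W] [Finite W] (S : Set W), CoxDescent.IsCoxeterSystem S →
      ∀ I : Set W, I ⊆ S →
      ∀ (f : Subgroup.closure I →* W) (T : Set (Subgroup.closure I)),
        f = (Subgroup.closure I).subtype → T = CoxDescent.parabolicGens I →
      -- The maps on `Σ` and `Λ` are restrictions, and the maps on `Σ*` are induced along `χ`.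
      ((CoxDescent.descentAlg S).subtype ∘ₗ CoxDescent.muSigma f T S =
          CoxDescent.mu f T S ∘ₗ (CoxDescent.descentAlg T).subtype ∧
        (CoxDescent.descentAlg T).subtype ∘ₗ CoxDescent.rhoSigma f T S =
          CoxDescent.rho f T S ∘ₗ (CoxDescent.descentAlg S).subtype ∧
        CoxDescent.muBarDual f T S ∘ₗ CoxDescent.chi T =
          CoxDescent.chi S ∘ₗ CoxDescent.muBar f T S ∧
        CoxDescent.rhoBarDual f T S ∘ₗ CoxDescent.chi S =
          CoxDescent.chi T ∘ₗ CoxDescent.rhoBar f T S) ∧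
      -- The horizontal arrows are surjections and injections.
      (Function.Surjective (CoxDescent.chiLam S) ∧ Function.Surjective (CoxDescent.chiLam T) ∧
        Function.Injective (CoxDescent.lam S).subtype ∧
        Function.Injective (CoxDescent.lam T).subtype) ∧
      -- The four squares commute.
      (CoxDescent.chiLam S ∘ₗ CoxDescent.muSigma f T S =
          CoxDescent.muBarLam f T S ∘ₗ CoxDescent.chiLam T ∧
        (CoxDescent.lam S).subtype ∘ₗ CoxDescent.muBarLam f T S =
          CoxDescent.muBarDual f T S ∘ₗ (CoxDescent.lam T).subtype ∧
        CoxDescent.chiLam T ∘ₗ CoxDescent.rhoSigma f T S =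
          CoxDescent.rhoBarLam f T S ∘ₗ CoxDescent.chiLam S ∧
        (CoxDescent.lam T).subtype ∘ₗ CoxDescent.rhoBarLam f T S =
          CoxDescent.rhoBarDual f T S ∘ₗ (CoxDescent.lam S).subtype) ∧
      -- Rotation by a half turn gives the dual diagram.
      ((∀ x φ, CoxDescent.rhoBarDual f T S φ x = φ (CoxDescent.muSigma f T S x)) ∧
        (∀ x φ, CoxDescent.muBarDual f T S φ x = φ (CoxDescent.rhoSigma f T S x)) ∧
        ∃ (C : LinearMap.BilinForm ℤ (CoxDescent.lam T))
          (B : LinearMap.BilinForm ℤ (CoxDescent.lam S)),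
          CoxDescent.IsLamForm T C ∧ CoxDescent.IsLamForm S B ∧
          (∀ x y, B (CoxDescent.chiLam S x) y = (CoxDescent.lam S).subtype y x) ∧
          (∀ x y, C (CoxDescent.chiLam T x) y = (CoxDescent.lam T).subtype y x) ∧
          (∀ x y, B (CoxDescent.muBarLam f T S x) y = C x (CoxDescent.rhoBarLam f T S y)))) ∧
    -- `Σ`, `Ω`, `Σ*` and `Λ` are representations of both categories, in commutative diamonds.
    (∃ (hΩ : CoxDescent.IsFunctorial CoxDescent.Omega.{u})
      (hS : CoxDescent.IsFunctorial CoxDescent.Sigma.{u})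
      (hD : CoxDescent.IsFunctorial CoxDescent.SigmaDual.{u})
      (hL : CoxDescent.IsFunctorial CoxDescent.Lambda.{u})
      (ι : CoxDescent.toFunctor _ hS ⟶ CoxDescent.toFunctor _ hΩ)
      (χ : CoxDescent.toFunctor _ hΩ ⟶ CoxDescent.toFunctor _ hD)
      (χL : CoxDescent.toFunctor _ hS ⟶ CoxDescent.toFunctor _ hL)
      (ιL : CoxDescent.toFunctor _ hL ⟶ CoxDescent.toFunctor _ hD),
      (∀ X, ι.app X = ModuleCat.ofHom (CoxDescent.descentAlg X.S).subtype) ∧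
      (∀ X, χ.app X = ModuleCat.ofHom (CoxDescent.chiInv X.S)) ∧
      (∀ X, χL.app X = ModuleCat.ofHom (CoxDescent.chiLam X.S)) ∧
      (∀ X, ιL.app X = ModuleCat.ofHom (CoxDescent.lam X.S).subtype) ∧
      Mono ι ∧ Epi χ ∧ Epi χL ∧ Mono ιL ∧ ι ≫ χ = χL ≫ ιL) ∧
    (∃ (hΩ : CoxDescent.IsFunctorial CoxDescent.OmegaOp.{u})
      (hS : CoxDescent.IsFunctorial CoxDescent.SigmaOp.{u})
      (hD : CoxDescent.IsFunctorial CoxDescent.SigmaDualOp.{u})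
      (hL : CoxDescent.IsFunctorial CoxDescent.LambdaOp.{u})
      (ι : CoxDescent.toFunctor _ hS ⟶ CoxDescent.toFunctor _ hΩ)
      (χ : CoxDescent.toFunctor _ hΩ ⟶ CoxDescent.toFunctor _ hD)
      (χL : CoxDescent.toFunctor _ hS ⟶ CoxDescent.toFunctor _ hL)
      (ιL : CoxDescent.toFunctor _ hL ⟶ CoxDescent.toFunctor _ hD),
      (∀ X, ι.app X = ModuleCat.ofHom (CoxDescent.descentAlg X.unop.S).subtype) ∧
      (∀ X, χ.app X = ModuleCat.ofHom (CoxDescent.chiInv X.unop.S)) ∧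
      (∀ X, χL.app X = ModuleCat.ofHom (CoxDescent.chiLam X.unop.S)) ∧
      (∀ X, ιL.app X = ModuleCat.ofHom (CoxDescent.lam X.unop.S).subtype) ∧
      Mono ι ∧ Epi χ ∧ Epi χL ∧ Mono ιL ∧ ι ≫ χ = χL ≫ ιL) ∧
    -- Duality of these representations: `Σ*` is dual to `Σ`, and `Λ` is self-dual.
    (∀ (X Y : CoxDescent.Cox.{u}) (e : X ⟶ Y),
      CoxDescent.rhoBarDual e.hom X.S Y.S = (CoxDescent.muSigma e.hom X.S Y.S).dualMap ∧
      CoxDescent.muBarDual e.hom X.S Y.S = (CoxDescent.rhoSigma e.hom X.S Y.S).dualMap ∧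
      ∀ (C : LinearMap.BilinForm ℤ (CoxDescent.lam X.S))
        (B : LinearMap.BilinForm ℤ (CoxDescent.lam Y.S)),
        CoxDescent.IsLamForm X.S C → CoxDescent.IsLamForm Y.S B →
        ∀ x y, B (CoxDescent.muBarLam e.hom X.S Y.S x) y =
          C x (CoxDescent.rhoBarLam e.hom X.S Y.S y)) := by
  obtain ⟨hform, hdiagram, hmu, hrho, hdual⟩ := mainTheorem6_general.{u}
  refine ⟨fun S _ => hform S, ?_, hmu, hrho, fun X Y e => hdual e.isParabolicEmbedding⟩
  rintro W _ _ S hS I hI f T rfl rfl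
  exact hdiagram (hS.isParabolicEmbedding_subtype hI)
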